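/- For $f\in L^2(\mathbb{R}^n)$ let $\widehat f$ denote its unitary Fourier transform, normalized by $\widehat f(\xi)=(2\pi)^{-n/2}\int e^{-ix\cdot\xi}f(x)\,dx$, and, when $\widehat f$ has compact support, let $$e^{it\Delta}f(x)=(2\pi)^{-n/2}\int_{\mathbb{R}^n} e^{i(x\cdot\xi+t|\xi|^2)}\,\widehat f(\xi)\,d\xi .$$ For $p\in[2,\infty]$ call $\gamma\in\mathbb{R}$ admissible for $(n,p)$ if for every $\varepsilon>0$ there is a constant $C_\varepsilon>0$ such that $$\Big\|\sup_{0<t\le R}|e^{it\Delta}f|\Big\|_{L^p(B^n(0,R))}\le C_\varepsilon R^{\varepsilon}R^{\gamma}\|f\|_{L^2}$$ for all $R>1$ and all $f\in L^2(\mathbb{R}^n)$ with $\operatorname{supp}\widehat f\subset B^n(0,1)$ (that is, $\widehat f=0$ almost everywhere outside the unit ball), and let $\bar\gamma_{n,p}$ be the infimum of the admissible $\gamma$. **Theorem.** Let $n\ge 3$ and $2\le p\le\infty$ (with $1/p=0$ for $p=\infty$). The set of admissible $\gamma$ is non-empty and bounded below, so that $\bar\gamma_{n,p}$ is a real number, and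 for every integer $1\le m\le n$, $$\bar\gamma_{n,p}\ \ge\ \frac{n+m}{2}\Big(\frac1p-\frac12\Big)+\frac{m}{2(m+1)} .$$ -/

import Mathlib

open MeasureTheory
open scoped ENNReal FourierTransform

namespace SchrodingerMaximal

noncomputable section

/-- `ℝⁿ` with its Euclidean norm and inner product. -/
abbrev Rn (n : ℕ) : Type := EuclideanSpace ℝ (Fin n)

/-- The space `L²(ℝⁿ)` of complex-valued functions. -/
abbrev L2 (n : ℕ) : Type := Lp (α := Rn n) ℂ 2

/-- The unitary Fourier transform on `L²(ℝⁿ)` in the angular-frequency normalization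
`f̂(ξ) = (2π)^{-n/2} ∫ e^{-i x·ξ} f(x) dx`. Mathlib's Fourier transform `𝓕` on `L²` extends
`𝓕 f (ξ) = ∫ e^{-2π i x·ξ} f(x) dx`, hence `f̂(ξ) = (2π)^{-n/2} (𝓕 f)(ξ / 2π)`. -/
def hat {n : ℕ} (f : L2 n) (ξ : Rn n) : ℂ :=
  (((2 * Real.pi) ^ (-(n : ℝ) / 2) : ℝ) : ℂ) * (𝓕 f : L2 n) ((2 * Real.pi)⁻¹ • ξ)

/-- `supp f̂ ⊆ B(0,1)`, for the (essential) support of the `L²` function `f̂`: it vanishes almost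
everywhere outside the unit ball. (The unit sphere is a null set.) -/
def FourierSupportedInUnitBall {n : ℕ} (f : L2 n) : Prop :=
  ∀ᵐ ξ : Rn n, ξ ∉ Metric.ball (0 : Rn n) 1 → hat f ξ = 0

/-- `e^{itΔ} f (x) = (2π)^{-n/2} ∫ e^{i (x·ξ + t |ξ|²)} f̂(ξ) dξ`. It is only applied to `f` with
compactly supported `f̂ ∈ L²`, for which the integral converges absolutely. -/
def schrodinger {n : ℕ} (t : ℝ) (f : L2 n) (x : Rn n) : ℂ :=
  (((2 * Real.pi) ^ (-(n : ℝ) / 2) : ℝ) : ℂ) *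
    ∫ ξ : Rn n, Complex.exp (Complex.I * ((inner ℝ x ξ + t * ‖ξ‖ ^ 2 : ℝ) : ℂ)) * hat f ξ

/-- The local maximal function `sup_{0 < t ≤ R} |e^{itΔ} f (x)|`, with values in `[0, ∞]`. -/
def maximalFunction {n : ℕ} (R : ℝ) (f : L2 n) (x : Rn n) : ℝ≥0∞ :=
  ⨆ t ∈ Set.Ioc (0 : ℝ) R, ‖schrodinger t f x‖ₑ

/-- The exponent `γ` is admissible for `(n, p)` if for every `ε > 0` there is a constant `C_ε > 0`
such that `‖sup_{0<t≤R} |e^{itΔ} f|‖_{L^p(B(0,R))} ≤ C_ε R^ε R^γ ‖f‖_{L²}` for all `R > 1` and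
all `f ∈ L²(ℝⁿ)` with `supp f̂ ⊆ B(0,1)`. -/
def IsAdmissible (n : ℕ) (p : ℝ≥0∞) (γ : ℝ) : Prop :=
  ∀ ε : ℝ, 0 < ε → ∃ C : ℝ, 0 < C ∧ ∀ R : ℝ, 1 < R → ∀ f : L2 n,
    FourierSupportedInUnitBall f →
      eLpNorm (maximalFunction R f) p (volume.restrict (Metric.ball (0 : Rn n) R)) ≤
        ENNReal.ofReal (C * R ^ ε * R ^ γ * ‖f‖)

/-- The optimal exponent: the infimum of all admissible exponents. -/
def optimalExponent (n : ℕ) (p : ℝ≥0∞) : ℝ :=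
  sInf {γ : ℝ | IsAdmissible n p γ}

end

end SchrodingerMaximal

namespace SchrodingerMaximal

/-! Some exponent is admissible because Cauchy–Schwarz on the unit ball bounds the maximal function
pointwise by a multiple of `‖f‖`. The content is the lower bound, which comes from a Bourgain-type
example.

Write `n = N + 1`, `m = d + 1`, let `K` be a large integer, `Q = K ^ d`, `R = K ^ 4 * Q ^ 2`. The
transform of `f` is a multiple of the indicator of a product set `Ω` (`freqSide`): in the first
coordinate an interval of length about `R^{-1/2}` starting at `κ`, in `d` coordinates a comb of
about `K Q` teeth of spacing `1 / (K Q)` and width about `1 / R`, in the others an interval of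
length about `R^{-1/2}` starting at `0`. The oscillatory integral factors over the coordinates.

At a time `t = π b (K Q)² / q` and at `x_j` near `2π K Q a_j / q`, the sum over the teeth is an
incomplete quadratic Gauss sum, so each comb loses only a factor of order `q^{-1/2}`
(`exists_norm_sum_quadPhase_sub_le`, `le_norm_integral_comb_osc`). By Dirichlet's theorem at least
half of a `d`-dimensional box of side about `R` consists of points with such approximations for a
common `q` comparable to `Q` (`half_le_volume_iUnion_tailSide`). The first coordinate selects the
time, through `x_1 ≈ -2 κ t`; by the lower bound on Euler's function these `x_1` have measure at
least of order `R / log K`.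

Hence the maximal function is at least of order `|Ω|^{1/2} Q^{-d/2} ‖f‖` on a subset of `B(0,R)` of
measure at least of order `R^m R^{(n-m)/2} / log K` (`exists_le_maximalFunction`). Comparing powers
of `K` gives the exponent (`le_of_isAdmissible`). -/

/-! ### Dirichlet approximation and counting residues prime to `q`. -/

theorem exists_simultaneous_approx {ι : Type*} [Fintype ι] (y : ι → ℝ) (K : ℕ) (hK : 0 < K) :
    ∃ q : ℕ, 0 < q ∧ q ≤ K ^ Fintype.card ι ∧ ∀ j, ∃ a : ℤ, |q * y j - a| ≤ 1 / K := by
  classical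
  have hK' : (0 : ℝ) < K := by exact_mod_cast hK
  -- Pigeonhole: two of the `K ^ card ι + 1` multiples `r y` have fractional parts in the same cell
  -- of side `1 / K`; the difference of the multipliers is the denominator.
  let box : ℕ → ι → Fin K := fun r j => ⟨⌊Int.fract (r * y j) * K⌋₊, by
    rw [Nat.floor_lt (by positivity)]
    have := Int.fract_lt_one (r * y j)
    nlinarith⟩
  obtain ⟨r, hr, s, hs, hrs, h⟩ : ∃ r ∈ Finset.range (K ^ Fintype.card ι + 1),
      ∃ s ∈ Finset.range (K ^ Fintype.card ι + 1), r ≠ s ∧ box r = box s := by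
    apply Finset.exists_ne_map_eq_of_card_lt_of_maps_to (t := Finset.univ)
    · simp
    · intro _ _; simp
  wlog hlt : r < s generalizing r s
  · exact this s hs r hr hrs.symm h.symm (by omega)
  refine ⟨s - r, by omega, by simp at hs; omega, fun j => ?_⟩
  refine ⟨⌊s * y j⌋ - ⌊r * y j⌋, ?_⟩
  have h1 : ⌊Int.fract (r * y j) * K⌋₊ = ⌊Int.fract (s * y j) * K⌋₊ :=
    congrArg Fin.val (congrFun h j)
  have e1 := Nat.floor_le (a := Int.fract (r * y j) * K) (by positivity)
  have e2 := Nat.floor_le (a := Int.fract (s * y j) * K) (by positivity)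
  have e3 := Nat.lt_floor_add_one (Int.fract (r * y j) * K)
  have e4 := Nat.lt_floor_add_one (Int.fract (s * y j) * K)
  rw [← h1] at e2 e4
  have : ((s - r : ℕ) : ℝ) * y j - ((⌊s * y j⌋ - ⌊r * y j⌋ : ℤ) : ℝ)
      = Int.fract (s * y j) - Int.fract (r * y j) := by
    rw [Nat.cast_sub hlt.le]; push_cast; simp only [Int.fract]; ring
  rw [this, le_div_iff₀ hK', ← abs_of_pos hK', ← abs_mul, abs_le]
  constructor <;> nlinarith

/-- Adjoin the elements in increasing order: a new maximum `a` is at least `S.card + 2`, so its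
factor is at least `(S.card + 1) / (S.card + 2)`, and these telescope. -/
theorem inv_card_add_one_le_prod (S : Finset ℕ) (hS : ∀ p ∈ S, 2 ≤ p) :
    1 / ((S.card : ℝ) + 1) ≤ ∏ p ∈ S, (1 - (p : ℝ)⁻¹) := by
  induction S using Finset.induction_on_max with
  | empty => simp
  | insert a S ha ih =>
    have hna : a ∉ S := fun h => lt_irrefl _ (ha a h)
    rw [Finset.prod_insert hna, Finset.card_insert_of_notMem hna]
    have ih := ih fun p hp => hS p (Finset.mem_insert_of_mem hp)
    have hcard : S.card + 2 ≤ a := by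
      have : S ⊆ Finset.Ico 2 a := fun p hp =>
        Finset.mem_Ico.2 ⟨hS p (Finset.mem_insert_of_mem hp), ha p hp⟩
      have h2 := Finset.card_le_card this
      have := hS a (Finset.mem_insert_self _ _)
      simp at h2; omega
    have hc : ((S.card : ℝ) + 2) ≤ a := by exact_mod_cast hcard
    have h3 : ((S.card : ℝ) + 1) / (S.card + 2) ≤ 1 - (a : ℝ)⁻¹ := by
      have : (a : ℝ)⁻¹ ≤ ((S.card : ℝ) + 2)⁻¹ := inv_anti₀ (by positivity) hc
      have e : ((S.card : ℝ) + 1) / (S.card + 2) = 1 - ((S.card : ℝ) + 2)⁻¹ := by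
        field_simp; ring
      linarith
    calc 1 / (((S.card + 1 : ℕ) : ℝ) + 1)
        = ((S.card : ℝ) + 1) / (S.card + 2) * (1 / ((S.card : ℝ) + 1)) := by
          push_cast; field_simp; ring
      _ ≤ _ := by gcongr; exact le_trans (by positivity) h3

/-- An integer `q` has at most `log₂ q ≤ 2 log q` distinct prime factors. The crude logarithmic loss
is harmless, being absorbed by `R ^ ε`. -/
theorem div_le_totient (q : ℕ) (hq : 0 < q) : (q : ℝ) / (1 + 2 * Real.log q) ≤ q.totient := by
  have h1 : (q.totient : ℝ) = q * ∏ p ∈ q.primeFactors, (1 - (p : ℝ)⁻¹) := by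
    have := Nat.totient_eq_mul_prod_factors q
    have h := congrArg (Rat.cast : ℚ → ℝ) this
    push_cast at h
    exact h
  have h2 := inv_card_add_one_le_prod q.primeFactors
    fun p hp => (Nat.prime_of_mem_primeFactors hp).two_le
  have h3 : (2 : ℕ) ^ q.primeFactors.card ≤ q :=
    (Finset.pow_card_le_prod _ _ _ fun p hp => (Nat.prime_of_mem_primeFactors hp).two_le).trans
      (Nat.le_of_dvd hq (Nat.prod_primeFactors_dvd q))
  have h4 : (q.primeFactors.card : ℝ) * Real.log 2 ≤ Real.log q := by
    rw [← Real.log_pow]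
    exact Real.log_le_log (by positivity) (by exact_mod_cast h3)
  have h5 := Real.log_two_gt_d9
  have h6 : (q.primeFactors.card : ℝ) ≤ 2 * Real.log q := by
    nlinarith [Nat.cast_nonneg (α := ℝ) q.primeFactors.card]
  rw [h1, div_eq_mul_one_div]
  gcongr
  refine le_trans ?_ h2
  gcongr ?_ / ?_
  · norm_num
  · linarith

theorem mul_totient_le_card_filter_coprime (q M : ℕ) :
    M * q.totient ≤ ((Finset.Ico 1 (1 + q * M)).filter fun b => q.Coprime b).card := by
  induction M with
  | zero => simp
  | succ M ih =>
    have hu : Finset.Ico 1 (1 + q * (M + 1)) =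
        Finset.Ico 1 (1 + q * M) ∪ Finset.Ico (1 + q * M) (1 + q * M + q) := by
      rw [Finset.Ico_union_Ico_eq_Ico (by omega) (by omega)]; ring_nf
    rw [hu, Finset.filter_union, Finset.card_union_of_disjoint, Nat.filter_coprime_Ico_eq_totient]
    · rw [add_mul]; omega
    · exact Finset.disjoint_filter_filter (Finset.Ico_disjoint_Ico_consecutive _ _ _)

/-! ### Complete and incomplete quadratic Gauss sums. -/

/-- The quadratic phase `exp (π i (b ℓ² + 2 a ℓ) / q)`. -/
noncomputable def quadPhase (q : ℕ) (b a ℓ : ℤ) : ℂ :=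
  Complex.exp (((Real.pi * ((b * ℓ ^ 2 + 2 * a * ℓ : ℤ) : ℝ) / q : ℝ) : ℂ) * Complex.I)

theorem exp_ofReal_mul_I_eq_of_sub_eq {x y : ℝ} (j : ℤ) (h : x - y = j * (2 * Real.pi)) :
    Complex.exp (x * Complex.I) = Complex.exp (y * Complex.I) := by
  rw [Complex.exp_eq_exp_iff_exists_int]
  refine ⟨j, ?_⟩
  have : x = y + j * (2 * Real.pi) := by linarith
  rw [this]; push_cast; ring

/-- The shift by `q` adds `π (2 b ℓ + b q + 2 a)` to the phase; evenness of `b q` makes this a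
multiple of `2π`. -/
theorem quadPhase_add_period (q : ℕ) (hq : 0 < q) (b a : ℤ) (hb : Even (b * q)) (ℓ : ℤ) :
    quadPhase q b a (ℓ + q) = quadPhase q b a ℓ := by
  obtain ⟨c, hc⟩ := hb
  refine exp_ofReal_mul_I_eq_of_sub_eq (b * ℓ + c + a) ?_
  have hq' : (q : ℝ) ≠ 0 := by exact_mod_cast hq.ne'
  have hc' : (b : ℝ) * q = c + c := by exact_mod_cast hc
  field_simp
  push_cast
  linear_combination (q : ℝ) * hc'

theorem sum_range_add_eq_of_periodic (F : ℤ → ℂ) (q : ℕ) (hF : ∀ ℓ, F (ℓ + q) = F ℓ) (s : ℕ) :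
    ∑ r ∈ Finset.range q, F (r + s) = ∑ r ∈ Finset.range q, F r := by
  induction s with
  | zero => simp
  | succ s ih =>
    rw [← ih]
    have h1 := Finset.sum_range_succ (fun r : ℕ => F (r + s)) q
    have h2 := Finset.sum_range_succ' (fun r : ℕ => F (r + s)) q
    rw [h1] at h2
    have h3 : F ((q : ℤ) + s) = F (((0 : ℕ) : ℤ) + s) := by
      rw [add_comm, hF]; simp
    rw [h3] at h2
    refine Eq.trans ?_ (add_right_cancel h2).symm
    refine Finset.sum_congr rfl fun r _ => ?_
    push_cast; ring_nf

/-- Orthogonality of the additive characters modulo `q`. -/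
theorem sum_exp_eq_ite (q : ℕ) (hq : 0 < q) (j : ℤ) :
    ∑ k ∈ Finset.range q, Complex.exp (((2 * Real.pi * (j * k) / q : ℝ) : ℂ) * Complex.I) =
      if (q : ℤ) ∣ j then (q : ℂ) else 0 := by
  have hq' : (q : ℝ) ≠ 0 := by exact_mod_cast hq.ne'
  have hqc : (q : ℂ) ≠ 0 := by exact_mod_cast hq.ne'
  set w : ℂ := Complex.exp (((2 * Real.pi * j / q : ℝ) : ℂ) * Complex.I) with hw
  have hpow : ∀ k : ℕ, Complex.exp (((2 * Real.pi * (j * k) / q : ℝ) : ℂ) * Complex.I) = w ^ k := by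
    intro k
    rw [hw, ← Complex.exp_nat_mul]
    congr 1; push_cast; ring
  simp_rw [hpow]
  split_ifs with h
  · obtain ⟨c, rfl⟩ := h
    have : w = 1 := by
      rw [hw, Complex.exp_eq_one_iff]
      refine ⟨c, ?_⟩
      push_cast; field_simp
    simp [this]
  · have hne : w ≠ 1 := by
      rw [hw, Ne, Complex.exp_eq_one_iff]
      rintro ⟨c, hc⟩
      apply h
      refine ⟨c, ?_⟩
      have h2 : ((2 * Real.pi * j / q : ℝ) : ℂ) * Complex.I =
          ((c * (2 * Real.pi) : ℝ) : ℂ) * Complex.I := by rw [hc]; push_cast; ring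
      have h3 := Complex.ofReal_injective (mul_right_cancel₀ Complex.I_ne_zero h2)
      field_simp at h3
      have h4 : (j : ℝ) = q * c := by
        have := Real.pi_pos
        nlinarith
      exact_mod_cast h4
    have hone : w ^ q = 1 := by
      rw [← hpow, Complex.exp_eq_one_iff]
      refine ⟨j, ?_⟩
      push_cast; field_simp
    rw [geom_sum_eq hne, hone]; simp

/-- Differencing a quadratic phase leaves a linear one in `s`, to which orthogonality of characters
applies. -/
theorem quadPhase_add_mul_conj (q : ℕ) (b a s h : ℤ) :
    quadPhase q b a (h + s) * (starRingEnd ℂ) (quadPhase q b a s) =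
      quadPhase q b a h *
        Complex.exp (((2 * Real.pi * ((b * h : ℤ) * s) / q : ℝ) : ℂ) * Complex.I) := by
  simp only [quadPhase]
  rw [← Complex.exp_conj, ← Complex.exp_add, ← Complex.exp_add]
  congr 1
  rw [map_mul, Complex.conj_ofReal, Complex.conj_I]
  push_cast
  ring

/-- The quadratic Gauss sums `∑_{r mod q} exp (π i (b r² + 2 a r) / q)` with `b` prime to `q` and
`b q` even have modulus `√q`. -/
theorem norm_sum_quadPhase (q : ℕ) (hq : 0 < q) (b a : ℤ) (hb : Even (b * q))
    (hbq : IsCoprime b (q : ℤ)) :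
    ‖∑ r ∈ Finset.range q, quadPhase q b a r‖ = Real.sqrt q := by
  set G := ∑ r ∈ Finset.range q, quadPhase q b a r with hG
  -- Rotating one factor by `s` turns `|G|²` into a sum over differences `h` of character sums in
  -- `s`. These vanish unless `q ∣ b h`, and coprimality then leaves only `h = 0`.
  have key : G * (starRingEnd ℂ) G = q := by
    have h1 : G * (starRingEnd ℂ) G = ∑ s ∈ Finset.range q, ∑ h ∈ Finset.range q,
        quadPhase q b a h *
          Complex.exp (((2 * Real.pi * ((b * h : ℤ) * s) / q : ℝ) : ℂ) * Complex.I) := by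
      rw [hG, map_sum, Finset.mul_sum]
      refine Finset.sum_congr rfl fun s _ => ?_
      rw [← sum_range_add_eq_of_periodic _ q (quadPhase_add_period q hq b a hb) s, Finset.sum_mul]
      refine Finset.sum_congr rfl fun h _ => ?_
      have := quadPhase_add_mul_conj q b a s h
      exact_mod_cast this
    rw [h1, Finset.sum_comm]
    simp_rw [← Finset.mul_sum, sum_exp_eq_ite q hq]
    rw [Finset.sum_eq_single 0]
    · simp [quadPhase]
    · intro h hh h0
      rw [if_neg, mul_zero]
      intro hd
      have := hbq.symm.dvd_of_dvd_mul_left hd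
      have h5 := Nat.le_of_dvd (Nat.pos_of_ne_zero h0) (Int.natCast_dvd_natCast.1 this)
      simp at hh; omega
    · simp [hq.ne']
  rw [Complex.mul_conj] at key
  have h2 : Complex.normSq G = q := by exact_mod_cast key
  rw [← h2, ← Complex.sq_norm, Real.sqrt_sq (norm_nonneg _)]

theorem quadPhase_mul_exp (q : ℕ) (b a k ℓ : ℤ) :
    quadPhase q b a ℓ * Complex.exp (((2 * Real.pi * (-k * ℓ) / q : ℝ) : ℂ) * Complex.I) =
      quadPhase q b (a - k) ℓ := by
  simp only [quadPhase]
  rw [← Complex.exp_add]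
  congr 1
  push_cast
  ring

/-- Finite Fourier expansion of a quadratic phase. -/
theorem quadPhase_eq_sum (q : ℕ) (hq : 0 < q) (b a : ℤ) (hb : Even (b * q)) (ℓ : ℕ) :
    quadPhase q b a ℓ = ∑ k ∈ Finset.range q,
      ((q : ℂ)⁻¹ * ∑ r ∈ Finset.range q, quadPhase q b (a - k) r) *
        Complex.exp (((2 * Real.pi * (k * ℓ) / q : ℝ) : ℂ) * Complex.I) := by
  have hqc : (q : ℂ) ≠ 0 := by exact_mod_cast hq.ne'
  -- Shifting each Gauss sum by `ℓ` moves the whole dependence on `k` into the character `exp (-2π i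
  -- r k / q)`; summing over `k` then retains `r = 0` alone.
  have h1 : ∀ k : ℕ, ∑ r ∈ Finset.range q, quadPhase q b (a - k) r =
      ∑ r ∈ Finset.range q, quadPhase q b (a - k) ((r : ℤ) + ℓ) := fun k =>
    (sum_range_add_eq_of_periodic _ q (quadPhase_add_period q hq b (a - k) hb) ℓ).symm
  simp_rw [h1, mul_assoc (q : ℂ)⁻¹, Finset.sum_mul, ← Finset.mul_sum]
  rw [Finset.sum_comm]
  have h2 : ∀ r k : ℕ, quadPhase q b (a - k) ((r : ℤ) + ℓ) *
      Complex.exp (((2 * Real.pi * (k * ℓ) / q : ℝ) : ℂ) * Complex.I) =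
      quadPhase q b a ((r : ℤ) + ℓ) *
        Complex.exp (((2 * Real.pi * ((-r : ℤ) * k) / q : ℝ) : ℂ) * Complex.I) := by
    intro r k
    rw [← quadPhase_mul_exp, mul_assoc, ← Complex.exp_add]
    congr 2
    push_cast
    ring
  simp_rw [h2, ← Finset.mul_sum, sum_exp_eq_ite q hq]
  rw [Finset.sum_eq_single 0]
  · simp; field_simp
  · intro r hr h0
    rw [if_neg, mul_zero]
    intro hd
    rw [dvd_neg] at hd
    have h5 := Nat.le_of_dvd (Nat.pos_of_ne_zero h0) (Int.natCast_dvd_natCast.1 hd)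
    simp at hr; omega
  · simp [hq.ne']

/-- The modulus is `2 |sin φ|` with `φ` half the angle. As `θ` is at most half the gap between
`q`-th roots of unity, `φ` stays away from `0` and `π`, and Jordan's inequality applies on either
side of `π / 2`. -/
theorem norm_exp_sub_one_ge {q k : ℕ} (hk : 0 < k) (hkq : k < q) {θ : ℝ}
    (hθ : |θ| ≤ Real.pi / q) :
    2 * (min (k : ℝ) (q - k) / q) ≤
      ‖Complex.exp (((2 * Real.pi * k / q + θ : ℝ) : ℂ) * Complex.I) - 1‖ := by
  have hq : (0 : ℝ) < q := by exact_mod_cast hk.trans hkq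
  have hk1 : (1 : ℝ) ≤ k := by exact_mod_cast hk
  have hkq1 : (k : ℝ) + 1 ≤ q := by exact_mod_cast hkq
  have hpi := Real.pi_pos
  rw [mul_comm _ Complex.I, Complex.norm_exp_I_mul_ofReal_sub_one, norm_mul, Real.norm_ofNat]
  gcongr
  obtain ⟨h1, h2⟩ := abs_le.1 hθ
  set φ := (2 * Real.pi * k / q + θ) / 2 with hφ
  have e1 : Real.pi * k / q - Real.pi / (2 * q) ≤ φ := by
    have : Real.pi / (2 * q) = Real.pi / q / 2 := by field_simp
    rw [hφ, this]; linarith [show 2 * Real.pi * k / q = 2 * (Real.pi * k / q) by ring]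
  have e2 : φ ≤ Real.pi * k / q + Real.pi / (2 * q) := by
    have : Real.pi / (2 * q) = Real.pi / q / 2 := by field_simp
    rw [hφ, this]; linarith [show 2 * Real.pi * k / q = 2 * (Real.pi * k / q) by ring]
  have f1 : Real.pi / 2 * (k / q) ≤ φ := by
    refine le_trans ?_ e1
    rw [← sub_nonneg]
    have : Real.pi * k / q - Real.pi / (2 * q) - Real.pi / 2 * (k / q) =
      Real.pi / (2 * q) * (k - 1) := by field_simp; ring
    rw [this]; exact mul_nonneg (by positivity) (by linarith)
  have f2 : Real.pi / 2 * ((q - k) / q) ≤ Real.pi - φ := by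
    rw [← sub_nonneg]
    have : Real.pi - (Real.pi * k / q + Real.pi / (2 * q)) - Real.pi / 2 * ((q - k) / q) =
      Real.pi / (2 * q) * (q - k - 1) := by field_simp; ring
    have h3 : 0 ≤ Real.pi / (2 * q) * (q - k - 1) := mul_nonneg (by positivity) (by linarith)
    linarith
  have hk0 : 0 ≤ (k : ℝ) / q := by positivity
  have hk0' : 0 ≤ ((q : ℝ) - k) / q := div_nonneg (by linarith) hq.le
  have hφ0 : 0 ≤ φ := le_trans (by positivity) f1
  have hφ1 : 0 ≤ Real.pi - φ := le_trans (by positivity) f2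
  refine le_trans ?_ (le_abs_self _)
  rw [← min_div_div_right hq.le]
  rcases le_total φ (Real.pi / 2) with h | h
  · have := Real.mul_le_sin hφ0 h
    refine le_trans (min_le_left _ _) (le_trans ?_ this)
    calc (k : ℝ) / q = 2 / Real.pi * (Real.pi / 2 * (k / q)) := by field_simp
      _ ≤ _ := by gcongr
  · have := Real.mul_le_sin hφ1 (by linarith)
    rw [Real.sin_pi_sub] at this
    refine le_trans (min_le_right _ _) (le_trans ?_ this)
    calc ((q : ℝ) - k) / q = 2 / Real.pi * (Real.pi / 2 * ((q - k) / q)) := by field_simp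
      _ ≤ _ := by gcongr

theorem norm_geom_sum_exp_le {q k : ℕ} (hk : 0 < k) (hkq : k < q) {θ : ℝ}
    (hθ : |θ| ≤ Real.pi / q) (L : ℕ) :
    ‖∑ ℓ ∈ Finset.range L,
        Complex.exp (((2 * Real.pi * k / q + θ : ℝ) : ℂ) * Complex.I) ^ ℓ‖ ≤
      q * ((k : ℝ)⁻¹ + ((q : ℝ) - k)⁻¹) := by
  have hq : (0 : ℝ) < q := by exact_mod_cast hk.trans hkq
  have hk0 : (0 : ℝ) < k := by exact_mod_cast hk
  have hkq0 : (0 : ℝ) < q - k := by rw [sub_pos]; exact_mod_cast hkq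
  have h := norm_exp_sub_one_ge hk hkq hθ
  set w := Complex.exp (((2 * Real.pi * k / q + θ : ℝ) : ℂ) * Complex.I) with hw
  have hwn : ‖w‖ = 1 := Complex.norm_exp_ofReal_mul_I _
  have hmin : 0 < min (k : ℝ) (q - k) := lt_min hk0 hkq0
  have hpos : 0 < 2 * (min (k : ℝ) (q - k) / q) := by positivity
  have hne : w ≠ 1 := by
    rintro h1
    rw [h1] at h
    simp only [sub_self, norm_zero] at h
    linarith
  rw [geom_sum_eq hne, norm_div]
  have hnum : ‖w ^ L - 1‖ ≤ 2 := by
    refine (norm_sub_le _ _).trans ?_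
    rw [norm_pow, hwn]; norm_num
  calc ‖w ^ L - 1‖ / ‖w - 1‖ ≤ 2 / (2 * (min (k : ℝ) (q - k) / q)) := by gcongr
    _ = q * (min (k : ℝ) (q - k))⁻¹ := by field_simp
    _ ≤ _ := by
      gcongr
      rcases le_total (k : ℝ) (q - k) with h | h
      · rw [min_eq_left h]; linarith [inv_pos.2 hkq0]
      · rw [min_eq_right h]; linarith [inv_pos.2 hk0]

theorem sum_inv_add_inv_le (q : ℕ) :
    ∑ k ∈ Finset.Ico 1 q, ((k : ℝ)⁻¹ + ((q : ℝ) - k)⁻¹) ≤ 2 * (1 + Real.log q) := by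
  have h1 : ∑ k ∈ Finset.Ico 1 q, ((q : ℝ) - k)⁻¹ = ∑ k ∈ Finset.Ico 1 q, (k : ℝ)⁻¹ := by
    have h := Finset.sum_Ico_reflect (fun k : ℕ => (k : ℝ)⁻¹) 1 (Nat.le_succ q)
    simp only [Nat.add_sub_cancel_left, Nat.add_sub_cancel] at h
    rw [← h]
    refine Finset.sum_congr rfl fun k hk => ?_
    rw [Nat.cast_sub (by simp at hk; omega)]
  have h2 : ∑ k ∈ Finset.Ico 1 q, (k : ℝ)⁻¹ ≤ 1 + Real.log q := by
    have := harmonic_le_one_add_log q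
    rw [harmonic_eq_sum_Icc] at this
    push_cast at this
    refine le_trans (Finset.sum_le_sum_of_subset_of_nonneg ?_ fun _ _ _ => by positivity) this
    intro k; simp; omega
  rw [Finset.sum_add_distrib, h1]; linarith

/-- A quadratic exponential sum twisted by a slowly varying phase is a multiple, of modulus
`q^{-1/2}`, of the geometric sum, up to an error `O(√q log q)`. -/
theorem exists_norm_sum_quadPhase_sub_le (q : ℕ) (hq : 0 < q) (b a : ℤ) (hb : Even (b * q))
    (hbq : IsCoprime b (q : ℤ)) (L : ℕ) :
    ∃ g : ℂ, ‖g‖ = (Real.sqrt q)⁻¹ ∧ ∀ θ : ℝ, |θ| ≤ Real.pi / q →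
      ‖∑ ℓ ∈ Finset.range L, quadPhase q b a ℓ * Complex.exp ((θ * ℓ : ℝ) * Complex.I) -
        g * ∑ ℓ ∈ Finset.range L, Complex.exp ((θ * ℓ : ℝ) * Complex.I)‖ ≤
        (Real.sqrt q)⁻¹ * (q * (2 * (1 + Real.log q))) := by
  have hq' : (0 : ℝ) < q := by exact_mod_cast hq
  set c : ℕ → ℂ := fun k => (q : ℂ)⁻¹ * ∑ r ∈ Finset.range q, quadPhase q b (a - k) r with hc
  have hcn : ∀ k, ‖c k‖ = (Real.sqrt q)⁻¹ := by
    intro k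
    rw [hc]
    simp only [norm_mul, norm_inv, Complex.norm_natCast]
    rw [norm_sum_quadPhase q hq b _ hb hbq]
    have := Real.sqrt_pos.2 hq'
    field_simp
    exact (Real.sq_sqrt hq'.le)
  refine ⟨c 0, hcn 0, fun θ hθ => ?_⟩
  have h1 : ∑ ℓ ∈ Finset.range L, quadPhase q b a ℓ * Complex.exp ((θ * ℓ : ℝ) * Complex.I) =
      ∑ k ∈ Finset.range q, c k * ∑ ℓ ∈ Finset.range L,
        Complex.exp (((2 * Real.pi * k / q + θ : ℝ) : ℂ) * Complex.I) ^ ℓ := by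
    simp_rw [Finset.mul_sum]
    rw [Finset.sum_comm]
    refine Finset.sum_congr rfl fun ℓ _ => ?_
    rw [quadPhase_eq_sum q hq b a hb ℓ, Finset.sum_mul]
    refine Finset.sum_congr rfl fun k _ => ?_
    rw [mul_assoc, ← Complex.exp_add, ← Complex.exp_nat_mul]
    congr 2
    push_cast
    ring
  have h2 : ∑ ℓ ∈ Finset.range L, Complex.exp ((θ * ℓ : ℝ) * Complex.I) =
      ∑ ℓ ∈ Finset.range L,
        Complex.exp (((2 * Real.pi * (0 : ℕ) / q + θ : ℝ) : ℂ) * Complex.I) ^ ℓ := by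
    refine Finset.sum_congr rfl fun ℓ _ => ?_
    rw [← Complex.exp_nat_mul]
    congr 1
    push_cast
    ring
  -- The frequency `k = 0` is the main term. All coefficients have modulus `q^{-1/2}`, and the other
  -- geometric sums add up to a harmonic sum, whence the logarithm.
  rw [h1, h2, Finset.range_eq_Ico, Finset.sum_eq_sum_Ico_succ_bot hq, add_sub_cancel_left]
  refine (norm_sum_le _ _).trans ?_
  simp_rw [norm_mul, hcn, ← Finset.mul_sum]
  gcongr
  refine le_trans (Finset.sum_le_sum fun k hk => ?_)
    (le_of_eq_of_le (Finset.mul_sum _ _ _).symm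
      (mul_le_mul_of_nonneg_left (sum_inv_add_inv_le q) hq'.le))
  have hk' := Finset.mem_Ico.1 hk
  exact norm_geom_sum_exp_le (by omega) (by omega) hθ L

/-! ### One-dimensional oscillatory integrals over intervals and combs. -/

/-- The one-dimensional oscillating factor `exp (i (x ξ + t ξ²))`. -/
noncomputable def osc (x t ξ : ℝ) : ℂ :=
  Complex.exp (((x * ξ + t * ξ ^ 2 : ℝ) : ℂ) * Complex.I)

@[fun_prop]
theorem continuous_osc (x t : ℝ) : Continuous (osc x t) := by
  unfold osc; fun_prop

theorem half_le_re_exp_of_abs_le_one {s : ℝ} (hs : |s| ≤ 1) :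
    1 / 2 ≤ (Complex.exp (s * Complex.I)).re := by
  rw [Complex.exp_ofReal_mul_I_re]
  have := Real.one_sub_sq_div_two_le_cos (x := s)
  have h2 : s ^ 2 ≤ 1 := (sq_le_one_iff_abs_le_one s).2 hs
  linarith

theorem mul_half_le_re_integral {w c : ℝ} (hw : 0 ≤ w) {F : ℝ → ℂ} (hF : Continuous F)
    (h : ∀ u ∈ Set.Icc 0 w, c ≤ (F u).re) : w * c ≤ (∫ u in (0 : ℝ)..w, F u).re := by
  have h1 : (∫ u in (0 : ℝ)..w, F u).re = ∫ u in (0 : ℝ)..w, (F u).re := by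
    have := Complex.reCLM.intervalIntegral_comp_comm (hF.intervalIntegrable (μ := volume) 0 w)
    simpa using this.symm
  rw [h1]
  have h2 := intervalIntegral.integral_mono_on (μ := volume) hw (f := fun _ => c) (g := fun u => (F u).re)
    (continuous_const.intervalIntegrable 0 w) ((Complex.continuous_re.comp hF).intervalIntegrable 0 w) h
  simpa using h2

theorem integral_Ioc_osc_eq (x t c w : ℝ) (hw : 0 ≤ w) :
    ∫ ξ in Set.Ioc c (c + w), osc x t ξ = ∫ u in (0 : ℝ)..w, osc x t (c + u) := by
  rw [intervalIntegral.integral_comp_add_left (fun ξ => osc x t ξ) c, add_zero,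
    intervalIntegral.integral_of_le (by linarith)]

/-- Over a short interval on which the phase hardly varies there is no cancellation. -/
theorem half_le_norm_integral_osc {x t c w : ℝ} (hw : 0 ≤ w)
    (h : ∀ u ∈ Set.Icc 0 w, |x * u + t * (2 * c * u + u ^ 2)| ≤ 1) :
    w / 2 ≤ ‖∫ ξ in Set.Ioc c (c + w), osc x t ξ‖ := by
  rw [integral_Ioc_osc_eq x t c w hw]
  have h1 : ∀ u, osc x t (c + u) = osc x t c *
      Complex.exp (((x * u + t * (2 * c * u + u ^ 2) : ℝ) : ℂ) * Complex.I) := by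
    intro u
    simp only [osc]
    rw [← Complex.exp_add]; congr 1; push_cast; ring
  simp_rw [h1]
  rw [intervalIntegral.integral_const_mul, norm_mul, osc, Complex.norm_exp_ofReal_mul_I, one_mul]
  refine le_trans ?_ (Complex.re_le_norm _)
  have := mul_half_le_re_integral hw (c := 1 / 2)
    (F := fun u => Complex.exp (((x * u + t * (2 * c * u + u ^ 2) : ℝ) : ℂ) * Complex.I))
    (by fun_prop) fun u hu => half_le_re_exp_of_abs_le_one (h u hu)
  linarith

/-- `L` equally spaced short intervals. -/
def comb (σ w : ℝ) (L : ℕ) : Set ℝ :=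
  ⋃ ℓ ∈ Finset.range L, Set.Ioc (σ * ℓ) (σ * ℓ + w)

theorem measurableSet_comb (σ w : ℝ) (L : ℕ) : MeasurableSet (comb σ w L) :=
  Finset.measurableSet_biUnion _ fun _ _ => measurableSet_Ioc

theorem pairwiseDisjoint_comb {σ w : ℝ} (hσ : 0 ≤ σ) (hwσ : w ≤ σ) (L : ℕ) :
    (Finset.range L : Set ℕ).PairwiseDisjoint
      fun ℓ : ℕ => Set.Ioc (σ * ℓ) (σ * ℓ + w) := by
  have key : ∀ i j : ℕ, i < j →
      Disjoint (Set.Ioc (σ * i) (σ * i + w)) (Set.Ioc (σ * j) (σ * j + w)) := by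
    intro i j hij
    rw [Set.disjoint_left]
    intro y hy hy'
    have : (i : ℝ) + 1 ≤ j := by exact_mod_cast hij
    have h1 := hy.2
    have h2 := hy'.1
    nlinarith
  intro i _ j _ hij
  rcases lt_or_gt_of_ne hij with h | h
  · exact key i j h
  · exact (key j i h).symm

theorem volume_comb {σ w : ℝ} (hσ : 0 ≤ σ) (hwσ : w ≤ σ) (L : ℕ) :
    volume (comb σ w L) = ENNReal.ofReal (L * w) := by
  rw [comb, measure_biUnion_finset (pairwiseDisjoint_comb hσ hwσ L)
    fun _ _ => measurableSet_Ioc]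
  simp [Real.volume_Ioc, ENNReal.ofReal_mul]

theorem integral_comb_osc_eq {σ w x t : ℝ} (hσ : 0 ≤ σ) (hw : 0 ≤ w) (hwσ : w ≤ σ) (L : ℕ) :
    ∫ ξ in comb σ w L, osc x t ξ =
      ∫ u in (0 : ℝ)..w, ∑ ℓ ∈ Finset.range L, osc x t (σ * ℓ + u) := by
  rw [comb, integral_biUnion_finset _ (fun _ _ => measurableSet_Ioc)
    (pairwiseDisjoint_comb hσ hwσ L)
    fun ℓ _ => ((continuous_osc x t).continuousOn.integrableOn_Icc.mono_set Set.Ioc_subset_Icc_self)]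
  rw [intervalIntegral.integral_finsetSum]
  · exact Finset.sum_congr rfl fun ℓ _ => integral_Ioc_osc_eq x t _ w hw
  · intro ℓ _
    exact Continuous.intervalIntegrable (by fun_prop) _ _

/-- Lower bound for the oscillating integral over a comb at a point where the phases are close to
rationals with denominator `q`. -/
theorem le_norm_integral_comb_osc {σ w x t β : ℝ} (hσ : 0 ≤ σ) (hw : 0 ≤ w) (hwσ : w ≤ σ)
    {q L : ℕ} (hq : 0 < q) {b a : ℤ} (hb : Even (b * q)) (hbq : IsCoprime b (q : ℤ))
    (ht : t * σ ^ 2 = Real.pi * b / q) (hx : σ * x = 2 * Real.pi * a / q + β)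
    (hθ : ∀ u ∈ Set.Icc 0 w, |β + 2 * t * σ * u| ≤ Real.pi / q)
    (hψ : ∀ u ∈ Set.Icc 0 w, ∀ ℓ < L,
      |x * u + t * u ^ 2 + (β + 2 * t * σ * u) * ℓ| ≤ 1) :
    w * (Real.sqrt q)⁻¹ * (L / 2 - q * (2 * (1 + Real.log q))) ≤
      ‖∫ ξ in comb σ w L, osc x t ξ‖ := by
  obtain ⟨g, hg, hG⟩ := exists_norm_sum_quadPhase_sub_le q hq b a hb hbq L
  have hq' : (q : ℝ) ≠ 0 := by exact_mod_cast hq.ne'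
  rw [integral_comb_osc_eq hσ hw hwσ]
  set D : ℝ → ℂ := fun u => ∑ ℓ ∈ Finset.range L,
    Complex.exp (((β + 2 * t * σ * u) * ℓ : ℝ) * Complex.I) with hD
  have hDc : Continuous D := by
    rw [hD]; fun_prop
  have h1 : ∀ u, ∑ ℓ ∈ Finset.range L, osc x t (σ * ℓ + u) = osc x t u *
      ∑ ℓ ∈ Finset.range L, quadPhase q b a ℓ *
        Complex.exp (((β + 2 * t * σ * u) * ℓ : ℝ) * Complex.I) := by
    intro u
    rw [Finset.mul_sum]
    refine Finset.sum_congr rfl fun ℓ _ => ?_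
    simp only [osc, quadPhase]
    rw [← Complex.exp_add, ← Complex.exp_add, ← add_mul, ← add_mul, ← Complex.ofReal_add,
      ← Complex.ofReal_add]
    congr 3
    have e1 : x * (σ * ℓ + u) + t * (σ * ℓ + u) ^ 2 =
      x * u + t * u ^ 2 + ((σ * x) * ℓ + (t * σ ^ 2) * ℓ ^ 2 + 2 * t * σ * u * ℓ) := by ring
    rw [e1, ht, hx]
    push_cast
    ring
  -- At offset `u` inside the teeth, the sum over teeth is a Gauss sum twisted by `θ = β + 2 t σ u`.
  -- Since `g` does not depend on `θ`, it comes out of the integral, leaving a main term without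
  -- cancellation and a uniformly small error.
  have h2 : ∫ u in (0 : ℝ)..w, ∑ ℓ ∈ Finset.range L, osc x t (σ * ℓ + u) =
      g * (∫ u in (0 : ℝ)..w, osc x t u * D u) +
      ∫ u in (0 : ℝ)..w, (∑ ℓ ∈ Finset.range L, osc x t (σ * ℓ + u) - g * (osc x t u * D u)) := by
    rw [intervalIntegral.integral_sub, intervalIntegral.integral_const_mul]
    · ring
    · exact Continuous.intervalIntegrable (by fun_prop) _ _
    · exact Continuous.intervalIntegrable (by fun_prop) _ _
  have h3 : ‖∫ u in (0 : ℝ)..w,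
      (∑ ℓ ∈ Finset.range L, osc x t (σ * ℓ + u) - g * (osc x t u * D u))‖ ≤
      (Real.sqrt q)⁻¹ * (q * (2 * (1 + Real.log q))) * |w - 0| := by
    refine intervalIntegral.norm_integral_le_of_norm_le_const fun u hu => ?_
    rw [Set.uIoc_of_le hw] at hu
    have := hG (β + 2 * t * σ * u) (hθ u ⟨hu.1.le, hu.2⟩)
    rw [h1, show ∀ A B C E : ℂ, A * B - E * (A * C) = A * (B - E * C) by intros; ring, norm_mul,
      osc, Complex.norm_exp_ofReal_mul_I, one_mul]
    exact this
  have h4 : w * (L / 2) ≤ ‖∫ u in (0 : ℝ)..w, osc x t u * D u‖ := by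
    refine le_trans (mul_half_le_re_integral hw (by fun_prop) fun u hu => ?_)
      (Complex.re_le_norm _)
    rw [hD]
    simp only
    rw [Finset.mul_sum, Complex.re_sum]
    have : ∀ ℓ ∈ Finset.range L, (1 / 2 : ℝ) ≤
        (osc x t u * Complex.exp (((β + 2 * t * σ * u) * ℓ : ℝ) * Complex.I)).re := by
      intro ℓ hℓ
      rw [osc, ← Complex.exp_add, ← add_mul, ← Complex.ofReal_add]
      exact half_le_re_exp_of_abs_le_one (hψ u hu ℓ (Finset.mem_range.1 hℓ))
    have := Finset.card_nsmul_le_sum _ _ _ this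
    rw [Finset.card_range, nsmul_eq_mul] at this
    linarith
  rw [h2]
  have h5 := norm_sub_le_norm_add (g * (∫ u in (0 : ℝ)..w, osc x t u * D u))
    (∫ u in (0 : ℝ)..w, (∑ ℓ ∈ Finset.range L, osc x t (σ * ℓ + u) - g * (osc x t u * D u)))
  rw [norm_mul, hg] at h5
  rw [sub_zero, abs_of_nonneg hw] at h3
  have h6 : (Real.sqrt q)⁻¹ * (w * (L / 2)) ≤
      (Real.sqrt q)⁻¹ * ‖∫ u in (0 : ℝ)..w, osc x t u * D u‖ := by gcongr
  linarith

/-! ### Initial data with prescribed transform, and the trivial upper bound. -/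

theorem quasiMeasurePreserving_const_smul {n : ℕ} {r : ℝ} (hr : r ≠ 0) :
    Measure.QuasiMeasurePreserving (fun ξ : Rn n => r • ξ) volume volume :=
  ⟨by fun_prop, by
    rw [Measure.map_addHaar_smul _ hr]
    exact Measure.smul_absolutelyContinuous⟩

theorem ae_comp_smul {n : ℕ} {r : ℝ} (hr : r ≠ 0) {P : Rn n → Prop} (h : ∀ᵐ η : Rn n, P η) :
    ∀ᵐ ξ : Rn n, P (r • ξ) :=
  (quasiMeasurePreserving_const_smul hr).ae h

/-- Initial data whose Fourier transform is a multiple of an indicator function. -/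
theorem exists_schrodinger_eq_integral {n : ℕ} {Ω : Set (Rn n)} (hΩ : MeasurableSet Ω)
    (hball : Ω ⊆ Metric.ball 0 1) :
    ∃ f : L2 n, FourierSupportedInUnitBall f ∧
      ‖f‖ = Real.sqrt (((2 * Real.pi) ^ n)⁻¹ * volume.real Ω) ∧
      ∀ t x, ‖schrodinger t f x‖ = ((2 * Real.pi) ^ n)⁻¹ *
        ‖∫ ξ in Ω, Complex.exp (Complex.I * ((inner ℝ x ξ + t * ‖ξ‖ ^ 2 : ℝ) : ℂ))‖ := by
  have hpi : 0 < 2 * Real.pi := Real.two_pi_pos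
  have hΩfin : volume Ω ≠ ∞ := ((measure_mono hball).trans_lt measure_ball_lt_top).ne
  set Ω' : Set (Rn n) := (fun η : Rn n => (2 * Real.pi) • η) ⁻¹' Ω with hΩ'
  have hm : MeasurableSet Ω' := hΩ.preimage (by fun_prop)
  have hvol : volume Ω' = ENNReal.ofReal ((2 * Real.pi) ^ n)⁻¹ * volume Ω := by
    rw [hΩ', Measure.addHaar_preimage_smul _ hpi.ne', abs_of_pos (by positivity)]
    simp
  have hfin : volume Ω' ≠ ∞ := by
    rw [hvol]; exact ENNReal.mul_ne_top ENNReal.ofReal_ne_top hΩfin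
  -- The set is rescaled by `2π` to match the normalization of `𝓕`. The resulting `hat` is
  -- `(2π)^{-n/2}` times the indicator of `Ω`; a second such factor comes from `schrodinger`.
  set g : L2 n := indicatorConstLp 2 hm hfin (1 : ℂ) with hg
  have hF : 𝓕 (𝓕⁻ g : L2 n) = g := FourierTransform.fourier_fourierInv_eq g
  set c : ℝ := (2 * Real.pi) ^ (-(n : ℝ) / 2) with hc
  have hhat : hat (𝓕⁻ g : L2 n) =ᵐ[volume] Ω.indicator fun _ => (c : ℂ) := by
    have h1 : ∀ᵐ η : Rn n, (g : Rn n → ℂ) η = Ω'.indicator (fun _ => (1 : ℂ)) η :=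
      indicatorConstLp_coeFn
    filter_upwards [ae_comp_smul (inv_ne_zero hpi.ne') h1] with ξ hξ
    rw [hat, hF, hξ]
    have : (2 * Real.pi)⁻¹ • ξ ∈ Ω' ↔ ξ ∈ Ω := by
      rw [hΩ', Set.mem_preimage, smul_inv_smul₀ hpi.ne']
    by_cases h : ξ ∈ Ω
    · rw [Set.indicator_of_mem h, Set.indicator_of_mem (this.2 h), mul_one]
    · rw [Set.indicator_of_notMem h, Set.indicator_of_notMem (mt this.1 h), mul_zero]
  refine ⟨𝓕⁻ g, ?_, ?_, fun t x => ?_⟩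
  · filter_upwards [hhat] with ξ hξ hn
    rw [hξ, Set.indicator_of_notMem fun h => hn (hball h)]
  · rw [← Lp.norm_fourier_eq, hF, hg, norm_indicatorConstLp (by norm_num) (by norm_num), norm_one,
      one_mul, Real.sqrt_eq_rpow, measureReal_def, hvol, ENNReal.toReal_mul,
      ENNReal.toReal_ofReal (by positivity), measureReal_def]
    norm_num
  · have h1 : ∫ ξ : Rn n, Complex.exp (Complex.I * ((inner ℝ x ξ + t * ‖ξ‖ ^ 2 : ℝ) : ℂ)) *
        hat (𝓕⁻ g : L2 n) ξ =
        (∫ ξ in Ω, Complex.exp (Complex.I * ((inner ℝ x ξ + t * ‖ξ‖ ^ 2 : ℝ) : ℂ))) * c := by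
      rw [← integral_mul_const, ← integral_indicator hΩ]
      refine integral_congr_ae ?_
      filter_upwards [hhat] with ξ hξ
      rw [hξ]
      by_cases h : ξ ∈ Ω <;> simp [h]
    rw [schrodinger, h1, norm_mul, norm_mul, Complex.norm_real, ← hc, Real.norm_of_nonneg
      (by positivity)]
    have h2 : ((2 * Real.pi) ^ n)⁻¹ = c * c := by
      rw [hc, ← Real.rpow_add hpi, ← Real.rpow_natCast, ← Real.rpow_neg hpi.le]
      congr 1; ring
    rw [h2]; ring

theorem exists_eLpNorm_hat_le (n : ℕ) :
    ∃ C : ℝ≥0∞, C ≠ ∞ ∧ ∀ f : L2 n, eLpNorm (hat f) 2 volume ≤ C * ‖f‖ₑ := by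
  have hpi : (2 * Real.pi)⁻¹ ≠ 0 := inv_ne_zero Real.two_pi_pos.ne'
  obtain ⟨A, hA⟩ : ∃ A : ℝ, Measure.map (fun ξ : Rn n => (2 * Real.pi)⁻¹ • ξ) volume =
      ENNReal.ofReal A • (volume : Measure (Rn n)) := ⟨_, Measure.map_addHaar_smul _ hpi⟩
  set c : ℂ := (((2 * Real.pi) ^ (-(n : ℝ) / 2) : ℝ) : ℂ) with hc
  refine ⟨‖c‖ₑ * ENNReal.ofReal A ^ (1 / (2 : ℝ≥0∞)).toReal, ?_, fun f => ?_⟩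
  · exact ENNReal.mul_ne_top enorm_ne_top
      (ENNReal.rpow_ne_top_of_nonneg (by positivity) ENNReal.ofReal_ne_top)
  have h1 : hat f = c • ((𝓕 f : L2 n) ∘ fun ξ : Rn n => (2 * Real.pi)⁻¹ • ξ) := by
    ext ξ; simp [hat, hc]
  have h2 : eLpNorm ((𝓕 f : L2 n) ∘ fun ξ : Rn n => (2 * Real.pi)⁻¹ • ξ) 2 volume =
      ENNReal.ofReal A ^ (1 / (2 : ℝ≥0∞)).toReal * ‖f‖ₑ := by
    have hmeas : AEStronglyMeasurable ((𝓕 f : L2 n) : Rn n → ℂ)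
        (Measure.map (fun ξ : Rn n => (2 * Real.pi)⁻¹ • ξ) volume) := by
      rw [hA]
      exact (Lp.aestronglyMeasurable _).smul_measure _
    rw [← eLpNorm_map_measure hmeas (by fun_prop), hA,
      eLpNorm_smul_measure_of_ne_top (by norm_num), smul_eq_mul, ← Lp.enorm_def]
    congr 1
    rw [← ofReal_norm, ← ofReal_norm, Lp.norm_fourier_eq]
  rw [h1, eLpNorm_const_smul, h2, mul_assoc]

/-- The `L¹` norm of `hat f` dominates, and on the unit ball it is controlled by the `L²` norm.
Uniformity in `t` and `x` makes this a bound for the maximal function. -/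
theorem exists_enorm_schrodinger_le (n : ℕ) :
    ∃ C : ℝ≥0∞, C ≠ ∞ ∧ ∀ f : L2 n, FourierSupportedInUnitBall f →
      ∀ t x, ‖schrodinger t f x‖ₑ ≤ C * ‖f‖ₑ := by
  obtain ⟨C, hC, hat_le⟩ := exists_eLpNorm_hat_le n
  set c : ℂ := (((2 * Real.pi) ^ (-(n : ℝ) / 2) : ℝ) : ℂ) with hc
  set B : Set (Rn n) := Metric.ball 0 1 with hB
  refine ⟨‖c‖ₑ * (C * volume B ^ (1 / (1 : ℝ≥0∞).toReal - 1 / (2 : ℝ≥0∞).toReal)), ?_,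
    fun f hf t x => ?_⟩
  · refine ENNReal.mul_ne_top enorm_ne_top (ENNReal.mul_ne_top hC
      (ENNReal.rpow_ne_top_of_nonneg (by norm_num) measure_ball_lt_top.ne))
  have hmeas : AEStronglyMeasurable (hat f) volume :=
    ((Lp.aestronglyMeasurable (𝓕 f : L2 n)).comp_quasiMeasurePreserving
      (quasiMeasurePreserving_const_smul (inv_ne_zero Real.two_pi_pos.ne'))).const_mul _
  rw [schrodinger, enorm_mul, ← hc, mul_assoc]
  gcongr
  calc ‖∫ ξ : Rn n, Complex.exp (Complex.I * ((inner ℝ x ξ + t * ‖ξ‖ ^ 2 : ℝ) : ℂ)) * hat f ξ‖ₑ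
      ≤ ∫⁻ ξ : Rn n, ‖Complex.exp (Complex.I * ((inner ℝ x ξ + t * ‖ξ‖ ^ 2 : ℝ) : ℂ)) * hat f ξ‖ₑ :=
        enorm_integral_le_lintegral_enorm _
    _ = ∫⁻ ξ : Rn n, B.indicator (fun ξ => ‖hat f ξ‖ₑ) ξ := by
        refine lintegral_congr_ae ?_
        filter_upwards [hf] with ξ hξ
        have h1 : ‖Complex.exp (Complex.I * ((inner ℝ x ξ + t * ‖ξ‖ ^ 2 : ℝ) : ℂ))‖ₑ = 1 := by
          rw [← ofReal_norm, mul_comm, Complex.norm_exp_ofReal_mul_I, ENNReal.ofReal_one]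
        rw [enorm_mul, h1, one_mul]
        by_cases h : ξ ∈ B
        · rw [Set.indicator_of_mem h]
        · rw [Set.indicator_of_notMem h, hξ h, enorm_zero]
    _ = eLpNorm (hat f) 1 (volume.restrict B) := by
        rw [lintegral_indicator Metric.isOpen_ball.measurableSet, eLpNorm_one_eq_lintegral_enorm]
    _ ≤ eLpNorm (hat f) 2 (volume.restrict B) *
          (volume.restrict B) Set.univ ^ (1 / (1 : ℝ≥0∞).toReal - 1 / (2 : ℝ≥0∞).toReal) :=
        eLpNorm_le_eLpNorm_mul_rpow_measure_univ (by norm_num) hmeas.restrict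
    _ ≤ (C * ‖f‖ₑ) * volume B ^ (1 / (1 : ℝ≥0∞).toReal - 1 / (2 : ℝ≥0∞).toReal) := by
        rw [Measure.restrict_apply_univ]
        gcongr
        exact (eLpNorm_mono_measure _ Measure.restrict_le_self).trans (hat_le f)
    _ = _ := by ring

/-- Some exponent is admissible. -/
theorem exists_isAdmissible (n : ℕ) (p : ℝ≥0∞) : ∃ γ : ℝ, IsAdmissible n p γ := by
  obtain ⟨C, hC, h⟩ := exists_enorm_schrodinger_le n
  set V : ℝ := (volume.real (Metric.ball (0 : Rn n) 1)) with hV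
  have hV0 : 0 ≤ V := measureReal_nonneg
  -- The exponent `n / p` is the power of `R` in the `L^p` norm of a constant on `B(0,R)`. For `p =
  -- ∞` the conventions `∞.toReal = 0` and `0⁻¹ = 0` give the correct value `0`.
  refine ⟨n * p.toReal⁻¹, fun ε hε => ⟨C.toReal * V ^ p.toReal⁻¹ + 1, by positivity,
    fun R hR f hf => ?_⟩⟩
  have hR0 : 0 < R := by linarith
  have h1 : eLpNorm (maximalFunction R f) p (volume.restrict (Metric.ball (0 : Rn n) R)) ≤
      (C * ‖f‖ₑ) • (volume.restrict (Metric.ball (0 : Rn n) R)) Set.univ ^ p.toReal⁻¹ := by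
    refine eLpNorm_le_of_ae_enorm_bound (Filter.Eventually.of_forall fun x => ?_)
    rw [enorm_eq_self]
    exact iSup₂_le fun t _ => h f hf t x
  refine h1.trans ?_
  have h2 : volume (Metric.ball (0 : Rn n) R) = ENNReal.ofReal (R ^ n * V) := by
    have := Measure.addHaar_ball_of_pos (volume : Measure (Rn n)) 0 hR0
    rw [this, ENNReal.ofReal_mul (by positivity), hV, ofReal_measureReal measure_ball_lt_top.ne]
    simp
  have h3 : C * ‖f‖ₑ = ENNReal.ofReal C.toReal * ‖f‖ₑ := by rw [ENNReal.ofReal_toReal hC]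
  rw [Measure.restrict_apply_univ, h2, smul_eq_mul, h3,
    ENNReal.ofReal_rpow_of_nonneg (by positivity) (by positivity), ← ofReal_norm,
    ← ENNReal.ofReal_mul (by positivity), ← ENNReal.ofReal_mul (by positivity)]
  apply ENNReal.ofReal_le_ofReal
  rw [Real.mul_rpow (by positivity) hV0, ← Real.rpow_natCast, ← Real.rpow_mul hR0.le]
  have h4 : 1 ≤ R ^ ε := Real.one_le_rpow hR.le hε.le
  calc C.toReal * ‖f‖ * (R ^ ((n : ℝ) * p.toReal⁻¹) * V ^ p.toReal⁻¹)
      = (C.toReal * V ^ p.toReal⁻¹) * 1 * R ^ ((n : ℝ) * p.toReal⁻¹) * ‖f‖ := by ring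
    _ ≤ _ := by gcongr; linarith

/-! ### Product sets and factorization of the integral. -/

/-- The product set `∏ A i` in `ℝⁿ`. -/
def box {n : ℕ} (A : Fin n → Set ℝ) : Set (Rn n) := {ξ | ∀ i, ξ i ∈ A i}

theorem toLp_preimage_box {n : ℕ} (A : Fin n → Set ℝ) :
    (WithLp.toLp 2 : (Fin n → ℝ) → Rn n) ⁻¹' box A = Set.univ.pi A := by
  ext y; simp [box]

theorem measurableSet_box {n : ℕ} {A : Fin n → Set ℝ} (hA : ∀ i, MeasurableSet (A i)) :
    MeasurableSet (box A) := by
  simp only [box, Set.ofPred_forall]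
  exact MeasurableSet.iInter fun i => (hA i).preimage (by fun_prop)

theorem volume_eq_volume_preimage_toLp {n : ℕ} {S : Set (Rn n)} (hS : MeasurableSet S) :
    volume S = volume ((WithLp.toLp 2 : (Fin n → ℝ) → Rn n) ⁻¹' S) :=
  ((PiLp.volume_preserving_toLp (Fin n)).measure_preimage hS.nullMeasurableSet).symm

theorem volume_box {n : ℕ} {A : Fin n → Set ℝ} (hA : ∀ i, MeasurableSet (A i)) :
    volume (box A) = ∏ i, volume (A i) := by
  rw [volume_eq_volume_preimage_toLp (measurableSet_box hA), toLp_preimage_box, volume_pi_pi]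

theorem exp_inner_add_eq_prod {n : ℕ} (x ξ : Rn n) (t : ℝ) :
    Complex.exp (Complex.I * ((inner ℝ x ξ + t * ‖ξ‖ ^ 2 : ℝ) : ℂ)) = ∏ i, osc (x i) t (ξ i) := by
  simp only [osc]
  rw [← Complex.exp_sum, ← Finset.sum_mul, ← Complex.ofReal_sum, mul_comm]
  congr 3
  rw [EuclideanSpace.real_norm_sq_eq, PiLp.inner_apply, Finset.sum_add_distrib, Finset.mul_sum]
  congr 1
  refine Finset.sum_congr rfl fun i _ => ?_
  simp [mul_comm]

theorem integral_box_eq_prod {n : ℕ} (A : Fin n → Set ℝ) (x : Rn n) (t : ℝ) :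
    ∫ ξ in box A, Complex.exp (Complex.I * ((inner ℝ x ξ + t * ‖ξ‖ ^ 2 : ℝ) : ℂ)) =
      ∏ i, ∫ s in A i, osc (x i) t s := by
  simp_rw [exp_inner_add_eq_prod]
  have h := (PiLp.volume_preserving_toLp (Fin n)).setIntegral_preimage_emb
    (MeasurableEquiv.toLp 2 (Fin n → ℝ)).measurableEmbedding
    (fun ξ : Rn n => ∏ i, osc (x i) t (ξ i)) (box A)
  rw [← h, toLp_preimage_box, volume_pi, Measure.restrict_pi_pi]
  exact integral_fintype_prod_eq_prod (fun i s => osc (x i) t s)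

/-- The function dominates a constant times an indicator. Writing the exponent as `(p⁻¹).toReal`
treats `p = ∞` at the same time, where it is `0` and `S` must not be null. -/
theorem eLpNorm_ge_of_le_on {n : ℕ} {p : ℝ≥0∞} (hp : p ≠ 0) {F : Rn n → ℝ≥0∞} {S B : Set (Rn n)}
    (hS : MeasurableSet S) (hSB : S ⊆ B) (hS0 : volume S ≠ 0) {lam : ℝ≥0∞}
    (h : ∀ x ∈ S, lam ≤ F x) :
    lam * volume S ^ (p⁻¹).toReal ≤ eLpNorm F p (volume.restrict B) := by
  have h1 : eLpNorm (S.indicator fun _ => lam) p (volume.restrict B) =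
      lam * volume S ^ (p⁻¹).toReal := by
    rw [eLpNorm_indicator_const' hS _ hp, Measure.restrict_apply hS,
      Set.inter_eq_left.2 hSB, enorm_eq_self, one_div, ENNReal.toReal_inv]
    rwa [Measure.restrict_apply hS, Set.inter_eq_left.2 hSB]
  rw [← h1]
  refine eLpNorm_mono_enorm fun x => ?_
  rw [enorm_eq_self, enorm_eq_self]
  by_cases hx : x ∈ S
  · rw [Set.indicator_of_mem hx]; exact h x hx
  · rw [Set.indicator_of_notMem hx]; exact zero_le

theorem prod_ite_val_lt {α : Type*} [CommMonoid α] {N d : ℕ} (hd : d ≤ N) (a b : α) :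
    ∏ i : Fin N, (if (i : ℕ) < d then a else b) = a ^ d * b ^ (N - d) := by
  obtain ⟨k, rfl⟩ := Nat.exists_eq_add_of_le hd
  rw [Fin.prod_univ_add]
  simp

/-! ### Measure of the points with good rational approximations. -/

/-- Points of `(0, r M]` at which `x / r` is within `1 / (q K)` of a rational of denominator `q`. -/
def nearRational (r : ℝ) (M K q : ℕ) : Set ℝ :=
  {x | x ∈ Set.Ioc 0 (r * M) ∧ ∃ a : ℤ, |q * (x / r) - a| ≤ 1 / K}

theorem measurableSet_nearRational (r : ℝ) (M K q : ℕ) :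
    MeasurableSet (nearRational r M K q) := by
  have : nearRational r M K q = Set.Ioc 0 (r * M) ∩
      ⋃ a : ℤ, {x : ℝ | |q * (x / r) - a| ≤ 1 / K} := by
    ext x; simp [nearRational]
  rw [this]
  exact measurableSet_Ioc.inter (MeasurableSet.iUnion fun a =>
    (isClosed_le (by fun_prop) (by fun_prop)).measurableSet)

/-- The set lies in `q M + 1` intervals of length `2 r / (q K)`. The bound is independent of `q`, so
small denominators can be discarded by a union bound. -/
theorem volume_nearRational_le {r : ℝ} (hr : 0 < r) {M K q : ℕ} (hM : 1 ≤ M) (hK : 2 ≤ K)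
    (hq : 1 ≤ q) : volume (nearRational r M K q) ≤ ENNReal.ofReal (4 * (r * M) / K) := by
  have hK' : (2 : ℝ) ≤ K := by exact_mod_cast hK
  have hq' : (1 : ℝ) ≤ q := by exact_mod_cast hq
  have hM' : (1 : ℝ) ≤ M := by exact_mod_cast hM
  have hq0 : (0 : ℝ) < q := by linarith
  have hsub : nearRational r M K q ⊆ ⋃ a ∈ Finset.range (q * M + 1),
      Metric.closedBall (r * a / q) (r / (q * K)) := by
    rintro x ⟨⟨hx0, hx1⟩, a, ha⟩
    have hinv : (1 : ℝ) / K < 1 := by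
      rw [div_lt_one (by linarith)]; linarith
    obtain ⟨h1, h2⟩ := abs_le.1 ha
    have hy0 : 0 < x / r := by positivity
    have hy1 : x / r ≤ M := by rw [div_le_iff₀ hr]; linarith
    have ha0 : 0 ≤ a := by
      have : (-1 : ℝ) < a := by nlinarith
      have : (-1 : ℤ) < a := by exact_mod_cast this
      omega
    have ha1 : a < q * M + 1 := by
      have : (a : ℝ) < q * M + 1 := by nlinarith
      exact_mod_cast this
    lift a to ℕ using ha0
    simp only [Set.mem_iUnion]
    refine ⟨a, Finset.mem_range.2 (by exact_mod_cast ha1), ?_⟩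
    rw [Metric.mem_closedBall, Real.dist_eq]
    have e : x - r * a / q = r / q * (q * (x / r) - (a : ℤ)) := by
      push_cast; field_simp
    rw [e, abs_mul, abs_of_pos (by positivity)]
    calc r / q * |q * (x / r) - (a : ℤ)| ≤ r / q * (1 / K) := by gcongr
      _ = _ := by field_simp
  refine (measure_mono hsub).trans ((measure_biUnion_finset_le _ _).trans ?_)
  simp_rw [Real.volume_closedBall]
  rw [Finset.sum_const, Finset.card_range, nsmul_eq_mul, ← ENNReal.ofReal_natCast,
    ← ENNReal.ofReal_mul (by positivity)]
  apply ENNReal.ofReal_le_ofReal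
  push_cast
  have h1 : (q : ℝ) * M + 1 ≤ 2 * (q * M) := by nlinarith
  calc ((q : ℝ) * M + 1) * (2 * (r / (q * K))) ≤ (2 * (q * M)) * (2 * (r / (q * K))) := by gcongr
    _ = _ := by field_simp; ring

/-- The sides, apart from the first one, of the boxes making up the set where the maximal function
is large. -/
def tailSide (N d : ℕ) (r s : ℝ) (M K q : ℕ) (i : Fin N) : Set ℝ :=
  if (i : ℕ) < d then nearRational r M K q else Set.Ioc 0 s

theorem measurableSet_tailSide (N d : ℕ) (r s : ℝ) (M K q : ℕ) (i : Fin N) :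
    MeasurableSet (tailSide N d r s M K q i) := by
  unfold tailSide
  split_ifs
  · exact measurableSet_nearRational r M K q
  · exact measurableSet_Ioc

/-- At least half of the points of a box have a simultaneous rational approximation of Dirichlet
quality whose denominator is not small. -/
theorem half_le_volume_iUnion_tailSide {N d K M : ℕ} (hd : d ≤ N) (hK : 2 ≤ K) (hM : 1 ≤ M)
    {r s : ℝ} (hr : 0 < r) (hs : 0 < s) :
    ENNReal.ofReal ((r * M) ^ d * s ^ (N - d) / 2) ≤
      volume (⋃ q ∈ Finset.Ioc (K ^ d / (2 * 4 ^ d)) (K ^ d),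
        Set.univ.pi (tailSide N d r s M K q)) := by
  -- Each denominator accounts for at most a fraction `(4 / K) ^ d` of the box, so those up to this
  -- threshold cover at most half of it.
  set q₀ := K ^ d / (2 * 4 ^ d) with hq₀
  set G := ⋃ q ∈ Finset.Ioc q₀ (K ^ d), Set.univ.pi (tailSide N d r s M K q) with hG
  set B := ⋃ q ∈ Finset.Ioc 0 q₀, Set.univ.pi (tailSide N d r s M K q) with hB
  have hK0 : (0 : ℝ) < K := by exact_mod_cast (by omega : 0 < K)
  set V := (r * M) ^ d * s ^ (N - d) with hV
  have hM0 : (0 : ℝ) < M := by exact_mod_cast hM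
  have hV0 : 0 < V := by positivity
  have hcover : Set.univ.pi (fun i : Fin N => if (i : ℕ) < d then Set.Ioc 0 (r * M) else
      Set.Ioc 0 s) ⊆ G ∪ B := by
    intro z hz
    obtain ⟨q, hq0, hqK, happ⟩ := exists_simultaneous_approx
      (fun j : Fin d => z (Fin.castLE hd j) / r) K (by omega)
    rw [Fintype.card_fin] at hqK
    have hmem : z ∈ Set.univ.pi (tailSide N d r s M K q) := by
      intro i _
      have := hz i trivial
      unfold tailSide
      split_ifs with h
      · simp only [h, if_true] at this
        exact ⟨this, happ ⟨i, h⟩⟩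
      · simpa only [h, if_false] using this
    by_cases h : q ≤ q₀
    · exact Or.inr (Set.mem_biUnion (Finset.mem_coe.2 (Finset.mem_Ioc.2 ⟨hq0, h⟩)) hmem)
    · exact Or.inl (Set.mem_biUnion
        (Finset.mem_coe.2 (Finset.mem_Ioc.2 ⟨not_le.1 h, hqK⟩)) hmem)
  have hfull : volume (Set.univ.pi (fun i : Fin N => if (i : ℕ) < d then Set.Ioc 0 (r * M) else
      Set.Ioc 0 s)) = ENNReal.ofReal V := by
    rw [volume_pi_pi]
    simp_rw [apply_ite volume, Real.volume_Ioc, sub_zero]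
    rw [prod_ite_val_lt hd, hV, ENNReal.ofReal_mul (p := (r * M) ^ d) (by positivity),
      ENNReal.ofReal_pow (by positivity), ENNReal.ofReal_pow hs.le]
  have hbad : volume B ≤ ENNReal.ofReal (V / 2) := by
    have h1 : ∀ q ∈ Finset.Ioc 0 q₀, volume (Set.univ.pi (tailSide N d r s M K q)) ≤
        ENNReal.ofReal ((4 * (r * M) / K) ^ d * s ^ (N - d)) := by
      intro q hq
      rw [volume_pi_pi, ENNReal.ofReal_mul (by positivity),
        ENNReal.ofReal_pow (by positivity), ENNReal.ofReal_pow hs.le, ← prod_ite_val_lt hd]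
      refine Finset.prod_le_prod' fun i _ => ?_
      unfold tailSide
      split_ifs
      · exact volume_nearRational_le hr hM hK (Finset.mem_Ioc.1 hq).1
      · rw [Real.volume_Ioc, sub_zero]
    refine (measure_biUnion_finset_le _ _).trans ((Finset.sum_le_sum h1).trans ?_)
    rw [Finset.sum_const, Nat.card_Ioc, Nat.sub_zero, nsmul_eq_mul, ← ENNReal.ofReal_natCast,
      ← ENNReal.ofReal_mul (by positivity)]
    apply ENNReal.ofReal_le_ofReal
    have h2 : (q₀ : ℝ) * (2 * 4 ^ d) ≤ K ^ d := by
      exact_mod_cast Nat.div_mul_le_self (K ^ d) (2 * 4 ^ d)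
    calc (q₀ : ℝ) * ((4 * (r * M) / K) ^ d * s ^ (N - d))
        = (q₀ * (2 * 4 ^ d)) * ((K : ℝ) ^ d)⁻¹ * (V / 2) := by
          rw [hV, div_pow, mul_pow]; field_simp
      _ ≤ K ^ d * ((K : ℝ) ^ d)⁻¹ * (V / 2) := by gcongr
      _ = V / 2 := by field_simp
  have h3 : ENNReal.ofReal V ≤ volume G + ENNReal.ofReal (V / 2) :=
    hfull ▸ (measure_mono hcover).trans ((measure_union_le _ _).trans (by gcongr))
  have h4 : ENNReal.ofReal (V / 2) = ENNReal.ofReal V - ENNReal.ofReal (V / 2) := by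
    rw [← ENNReal.ofReal_sub _ (by positivity)]; congr 1; ring
  rw [h4]
  exact tsub_le_iff_right.2 h3

theorem volume_iUnion_ball_neg_mul (B : Finset ℕ) {h ρ : ℝ} (hρ : 2 * ρ ≤ h) (hρ0 : 0 ≤ ρ) :
    volume (⋃ b ∈ B, Metric.ball (-(h * b)) ρ) = ENNReal.ofReal (B.card * (2 * ρ)) := by
  rw [measure_biUnion_finset _ fun _ _ => measurableSet_ball]
  · simp_rw [Real.volume_ball]
    rw [Finset.sum_const, nsmul_eq_mul, ENNReal.ofReal_mul (p := (B.card : ℝ)) (by positivity),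
      ENNReal.ofReal_natCast]
  · intro i _ j _ hij
    apply Metric.ball_disjoint_ball
    rw [Real.dist_eq, show -(h * (i : ℝ)) - -(h * j) = h * (j - i) by ring, abs_mul,
      abs_of_nonneg (by linarith)]
    have : (1 : ℝ) ≤ |(j : ℝ) - i| := by
      have h1 : (1 : ℤ) ≤ |(j : ℤ) - i| := Int.one_le_abs (by omega)
      exact_mod_cast h1
    nlinarith

/-- Lower bound for the measure of a set whose sections along the first coordinate are large. -/
theorem mul_le_volume_of_section {N : ℕ} {S : Set (Fin (N + 1) → ℝ)} (hS : MeasurableSet S)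
    {G : Set (Fin N → ℝ)} (hG : MeasurableSet G) {v : ℝ≥0∞}
    (h : ∀ z ∈ G, v ≤ volume {s : ℝ | Fin.cons s z ∈ S}) :
    v * volume G ≤ volume S := by
  set e := MeasurableEquiv.piFinSuccAbove (fun _ : Fin (N + 1) => ℝ) 0 with he
  have hmp := (volume_preserving_piFinSuccAbove (fun _ : Fin (N + 1) => ℝ) 0).symm
  rw [← hmp.measure_preimage hS.nullMeasurableSet]
  have hm : MeasurableSet (e.symm ⁻¹' S) := hS.preimage e.symm.measurable
  have key : volume (e.symm ⁻¹' S) = ∫⁻ z, volume {s : ℝ | Fin.cons s z ∈ S} := by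
    rw [Measure.volume_eq_prod, Measure.prod_apply_symm hm]
    refine lintegral_congr fun z => congrArg volume ?_
    ext s
    change Fin.insertNth 0 s z ∈ S ↔ Fin.cons s z ∈ S
    rw [Fin.insertNth_zero']
  rw [← he, key, ← setLIntegral_const]
  refine le_trans ?_ (setLIntegral_le_lintegral G _)
  exact setLIntegral_mono' hG fun z hz => h z hz

theorem norm_le_card_mul_of_forall_abs_le {n : ℕ} {x : Rn n} {c : ℝ} (hc : 0 ≤ c)
    (h : ∀ i, |x i| ≤ c) : ‖x‖ ≤ n * c := by
  refine le_of_sq_le_sq ?_ (by positivity)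
  rw [EuclideanSpace.real_norm_sq_eq]
  calc ∑ i, x i ^ 2 ≤ ∑ _i : Fin n, c ^ 2 := by
        refine Finset.sum_le_sum fun i _ => ?_
        rw [← sq_abs]
        gcongr
        exact h i
    _ = n * c ^ 2 := by simp
    _ ≤ (n * c) ^ 2 := by
        rw [mul_pow]
        gcongr
        rcases Nat.eq_zero_or_pos n with rfl | hn
        · simp
        · have : (1 : ℝ) ≤ n := by exact_mod_cast hn
          nlinarith

/-! ### Lower bounds for the factors at the scales of the example. -/

/-- With `R = k ^ 4 * Q ^ 2`, an interval of length `κ R^{-1/2}` sees a phase variation of at most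
`κ + κ²` up to time `R`, provided `x` is within `R^{1/2}` of the ray `-2 c t`. It serves the first
coordinate with `c = κ` and the non-comb ones with `c = 0`. -/
theorem le_norm_integral_wavePacket {κ k Q t x : ℝ} (hκ : 0 < κ) (hκ1 : κ ≤ 1 / 100) (hk : 1 ≤ k)
    (hQ : 1 ≤ Q) (ht0 : 0 ≤ t) (ht : t ≤ k ^ 4 * Q ^ 2) {c : ℝ}
    (hx : |x + 2 * c * t| ≤ k ^ 2 * Q) :
    κ / (k ^ 2 * Q) / 2 ≤ ‖∫ ξ in Set.Ioc c (c + κ / (k ^ 2 * Q)), osc x t ξ‖ := by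
  refine half_le_norm_integral_osc (by positivity) fun u hu => ?_
  obtain ⟨hu0, hu1⟩ := hu
  have e : x * u + t * (2 * c * u + u ^ 2) = (x + 2 * c * t) * u + t * u ^ 2 := by ring
  rw [e]
  calc |(x + 2 * c * t) * u + t * u ^ 2| ≤ |x + 2 * c * t| * u + t * u ^ 2 := by
        refine (abs_add_le _ _).trans ?_
        rw [abs_mul, abs_of_nonneg hu0, abs_of_nonneg (by positivity : 0 ≤ t * u ^ 2)]
    _ ≤ k ^ 2 * Q * (κ / (k ^ 2 * Q)) + k ^ 4 * Q ^ 2 * (κ / (k ^ 2 * Q)) ^ 2 := by gcongr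
    _ = κ + κ ^ 2 := by field_simp
    _ ≤ 1 := by nlinarith

/-- Both the Dirichlet error and the drift `2 t σ u` are `O(1 / (q k))` per tooth. Over at most `κ k
Q` teeth this accumulates to `O(κ Q / q)`, which is small only because `q` is at least `Q / (2 D)`.
-/
theorem le_norm_integral_comb_of_nearRational {κ k Q t x D : ℝ} {L q : ℕ} {b a : ℤ}
    (hκ : 0 < κ) (hD : 1 ≤ D) (hκD : κ * D ≤ 1 / 100) (hk : 3 ≤ k)
    (hq : 0 < q) (hqQ : q ≤ Q) (hQq : Q ≤ 2 * D * q) (hL : L ≤ κ * (k * Q))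
    (hlog : q * (2 * (1 + Real.log q)) ≤ L / 4)
    (ht0 : 0 ≤ t) (ht : t ≤ k ^ 4 * Q ^ 2) (htb : t = Real.pi * b * (k * Q) ^ 2 / q)
    (hb : Even (b * q)) (hbq : IsCoprime b (q : ℤ))
    (hx0 : 0 ≤ x) (hx : x ≤ k ^ 4 * Q ^ 2) (ha : |q * (x / (2 * Real.pi * (k * Q))) - a| ≤ 1 / k) :
    L * (κ / (k ^ 4 * Q ^ 2)) * (Real.sqrt q)⁻¹ / 4 ≤
      ‖∫ ξ in comb (1 / (k * Q)) (κ / (k ^ 4 * Q ^ 2)) L, osc x t ξ‖ := by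
  have hpi := Real.pi_pos
  have hpi4 := Real.pi_le_four
  have hpi3 := Real.pi_gt_three
  have hq1 : (1 : ℝ) ≤ q := by exact_mod_cast hq
  have hQ1 : 1 ≤ Q := hq1.trans hqQ
  have hκ1 : κ ≤ 1 / 100 := by nlinarith
  have hk0 : 0 < k := by linarith
  set σ := 1 / (k * Q) with hσ
  set w := κ / (k ^ 4 * Q ^ 2) with hw
  set β := 2 * Real.pi / q * (q * (x / (2 * Real.pi * (k * Q))) - a) with hβ
  have hσ0 : 0 < σ := by positivity
  have hw0 : 0 < w := by positivity
  have hwσ : w ≤ σ := by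
    rw [hw, hσ, div_le_div_iff₀ (by positivity) (by positivity)]
    have h1 : 1 ≤ k ^ 3 := one_le_pow₀ (by linarith)
    have h2 : (1 : ℝ) ≤ k ^ 3 * Q := one_le_mul_of_one_le_of_one_le h1 hQ1
    have h3 : κ ≤ k ^ 3 * Q := by linarith
    calc κ * (k * Q) ≤ (k ^ 3 * Q) * (k * Q) := by gcongr
      _ = 1 * (k ^ 4 * Q ^ 2) := by ring
  have hβ1 : |β| ≤ 2 * Real.pi / (q * k) := by
    rw [hβ, abs_mul, abs_of_pos (by positivity)]
    calc 2 * Real.pi / q * |q * (x / (2 * Real.pi * (k * Q))) - a|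
        ≤ 2 * Real.pi / q * (1 / k) := by gcongr
      _ = _ := by field_simp
  have hθ : ∀ u ∈ Set.Icc 0 w, |β + 2 * t * σ * u| ≤ 9 / (q * k) := by
    rintro u ⟨hu0, hu1⟩
    have h1 : 2 * t * σ * u ≤ 1 / (q * k) := by
      calc 2 * t * σ * u ≤ 2 * (k ^ 4 * Q ^ 2) * σ * w := by gcongr
        _ = 2 * κ / (Q * k) := by rw [hσ, hw]; field_simp
        _ ≤ 1 / (q * k) := by gcongr; linarith
    have h0 : 0 ≤ 2 * t * σ * u := by positivity
    calc |β + 2 * t * σ * u| ≤ |β| + 2 * t * σ * u := by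
          refine (abs_add_le _ _).trans ?_
          rw [abs_of_nonneg h0]
      _ ≤ 2 * Real.pi / (q * k) + 1 / (q * k) := by gcongr
      _ = (2 * Real.pi + 1) / (q * k) := by ring
      _ ≤ _ := by gcongr; linarith
  have key := le_norm_integral_comb_osc (σ := σ) (w := w) (x := x) (t := t) (β := β) (L := L)
    hσ0.le hw0.le hwσ hq (a := a) hb hbq ?_ ?_ ?_ ?_
  · refine le_trans ?_ key
    have : (L : ℝ) / 4 ≤ L / 2 - q * (2 * (1 + Real.log q)) := by linarith
    calc L * w * (Real.sqrt q)⁻¹ / 4 = w * (Real.sqrt q)⁻¹ * (L / 4) := by ring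
      _ ≤ _ := by gcongr
  · rw [htb, hσ]; field_simp
  · rw [hβ, hσ]; field_simp; ring
  · intro u hu
    refine (hθ u hu).trans ?_
    rw [div_le_div_iff₀ (by positivity) (by positivity)]
    -- This is where `3 ≤ k` is needed: the twist must not exceed half the gap between `q`-th roots
    -- of unity.
    have : 9 ≤ Real.pi * k := by nlinarith
    nlinarith
  · intro u hu ℓ hℓ
    have hu0 := hu.1
    have hu1 := hu.2
    have hℓ' : (ℓ : ℝ) ≤ κ * (k * Q) := le_trans (by exact_mod_cast hℓ.le) hL
    have h1 : x * u ≤ κ := by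
      calc x * u ≤ k ^ 4 * Q ^ 2 * w := by gcongr
        _ = κ := by rw [hw]; field_simp
    have h2 : t * u ^ 2 ≤ κ ^ 2 := by
      calc t * u ^ 2 ≤ k ^ 4 * Q ^ 2 * w ^ 2 := by gcongr
        _ = κ ^ 2 / (k ^ 4 * Q ^ 2) := by rw [hw]; field_simp
        _ ≤ κ ^ 2 := by
          apply div_le_self (by positivity)
          exact one_le_mul_of_one_le_of_one_le (one_le_pow₀ (by linarith)) (one_le_pow₀ hQ1)
    have h3 : |(β + 2 * t * σ * u) * ℓ| ≤ 18 / 100 := by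
      rw [abs_mul, abs_of_nonneg (by positivity : (0 : ℝ) ≤ ℓ)]
      calc |β + 2 * t * σ * u| * ℓ ≤ 9 / (q * k) * (κ * (k * (2 * D * q))) := by
            refine mul_le_mul (hθ u hu) (hℓ'.trans ?_) (by positivity) (by positivity)
            gcongr
        _ = 18 * (κ * D) := by field_simp; ring
        _ ≤ _ := by linarith
    calc |x * u + t * u ^ 2 + (β + 2 * t * σ * u) * ℓ|
        ≤ x * u + t * u ^ 2 + |(β + 2 * t * σ * u) * ℓ| := by
          refine (abs_add_le _ _).trans ?_
          rw [abs_of_nonneg (by positivity : 0 ≤ x * u + t * u ^ 2)]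
      _ ≤ 1 := by nlinarith

/-! ### The example: frequency set, large set and focusing times. -/

/-- `1` for even `q` and `2` for odd `q`, so that `parityFactor q * b * q` is always even. -/
def parityFactor (q : ℕ) : ℕ := if Even q then 1 else 2

theorem one_le_parityFactor (q : ℕ) : 1 ≤ parityFactor q := by
  unfold parityFactor; split_ifs <;> norm_num

theorem parityFactor_le_two (q : ℕ) : parityFactor q ≤ 2 := by
  unfold parityFactor; split_ifs <;> norm_num

theorem even_parityFactor_mul (q b : ℕ) :
    Even (((parityFactor q * b : ℕ) : ℤ) * (q : ℤ)) := by
  rw [← Nat.cast_mul, Int.even_coe_nat]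
  unfold parityFactor
  split_ifs with h
  · exact h.mul_left _
  · exact ((even_two).mul_right b).mul_right q

theorem isCoprime_parityFactor_mul {q b : ℕ} (h : q.Coprime b) :
    IsCoprime ((parityFactor q * b : ℕ) : ℤ) (q : ℤ) := by
  rw [Nat.isCoprime_iff_coprime]
  refine Nat.Coprime.mul_left ?_ h.symm
  unfold parityFactor
  split_ifs with h
  · exact Nat.coprime_one_left q
  · exact (Nat.coprime_two_left).2 (Nat.not_even_iff_odd.1 h)

/-- The sides of the frequency support of the example. -/
def freqSide (κ k Q : ℝ) (N d L : ℕ) : Fin (N + 1) → Set ℝ :=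
  Fin.cons (Set.Ioc κ (κ + κ / (k ^ 2 * Q))) fun i : Fin N =>
    if (i : ℕ) < d then comb (1 / (k * Q)) (κ / (k ^ 4 * Q ^ 2)) L
    else Set.Ioc 0 (0 + κ / (k ^ 2 * Q))

/-- The first coordinates for which the wave packet is focused at a time adapted to `q`. -/
def headSide (κ k Q : ℝ) (M q : ℕ) : Set ℝ :=
  ⋃ b ∈ (Finset.Ico 1 (1 + q * M)).filter (fun b => q.Coprime b),
    Metric.ball (-(2 * κ * (Real.pi * parityFactor q * (k * Q) ^ 2 / q) * b))
      (κ * Real.pi * (k ^ 2 * Q))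

theorem measurableSet_headSide (κ k Q : ℝ) (M q : ℕ) : MeasurableSet (headSide κ k Q M q) :=
  Finset.measurableSet_biUnion _ fun _ _ => measurableSet_ball

/-- There are at least `M φ(q)` balls, and they are disjoint: the spacing of their centres carries a
factor `Q² / q ≥ Q`, so it is at least their diameter. -/
theorem le_volume_headSide {κ k Q D Λ : ℝ} {M q : ℕ} (hκ : 0 < κ) (hk : 1 ≤ k)
    (hD : 1 ≤ D) (hq : 0 < q) (hqQ : q ≤ Q) (hQq : Q ≤ 2 * D * q)
    (hΛ : 1 + 2 * Real.log q ≤ Λ) (hM : κ * k ^ 2 / 2 ≤ M) :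
    ENNReal.ofReal (κ ^ 2 * Real.pi / (2 * D) * (k ^ 4 * Q ^ 2) / Λ) ≤
      volume (headSide κ k Q M q) := by
  have hpi := Real.pi_pos
  have hq1 : (1 : ℝ) ≤ q := by exact_mod_cast hq
  have hQ1 : 1 ≤ Q := hq1.trans hqQ
  have hlog : 0 ≤ Real.log q := Real.log_nonneg hq1
  have he : (1 : ℝ) ≤ parityFactor q := by exact_mod_cast one_le_parityFactor q
  unfold headSide
  rw [volume_iUnion_ball_neg_mul _ _ (by positivity)]
  · apply ENNReal.ofReal_le_ofReal
    have h1 : (M : ℝ) * q.totient ≤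
        ((Finset.Ico 1 (1 + q * M)).filter fun b => q.Coprime b).card := by
      exact_mod_cast mul_totient_le_card_filter_coprime q M
    have h2 : Q / (2 * D) / Λ ≤ q.totient := by
      refine le_trans ?_ (div_le_totient q hq)
      gcongr
      rw [div_le_iff₀ (by positivity)]; linarith
    have hΛ0 : 0 < Λ := by linarith
    calc κ ^ 2 * Real.pi / (2 * D) * (k ^ 4 * Q ^ 2) / Λ
        = (κ * k ^ 2 / 2) * (Q / (2 * D) / Λ) * (2 * (κ * Real.pi * (k ^ 2 * Q))) := by
          field_simp
      _ ≤ M * q.totient * (2 * (κ * Real.pi * (k ^ 2 * Q))) := by gcongr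
      _ ≤ _ := by gcongr
  · have : Q ≤ Q ^ 2 / q := by
      rw [le_div_iff₀ (by linarith)]; nlinarith
    calc 2 * (κ * Real.pi * (k ^ 2 * Q)) = 2 * κ * (Real.pi * 1 * (k ^ 2 * Q)) := by ring
      _ ≤ 2 * κ * (Real.pi * parityFactor q * (k ^ 2 * (Q ^ 2 / q))) := by gcongr
      _ = _ := by ring

/-- The set on which the maximal function of the example is large. -/
def largeSet (κ : ℝ) (N d K M₁ M₂ : ℕ) : Set (Rn (N + 1)) :=
  ⋃ q ∈ Finset.Ioc (K ^ d / (2 * 4 ^ d)) (K ^ d),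
    box (Fin.cons (headSide κ K (K ^ d) M₁ q)
      (tailSide N d (2 * Real.pi * (K * K ^ d)) (K ^ 2 * K ^ d) M₂ K q))

theorem measurableSet_largeSet (κ : ℝ) (N d K M₁ M₂ : ℕ) :
    MeasurableSet (largeSet κ N d K M₁ M₂) := by
  refine Finset.measurableSet_biUnion _ fun q _ => measurableSet_box fun i => ?_
  refine Fin.cases ?_ (fun i => ?_) i
  · exact measurableSet_headSide _ _ _ _ _
  · exact measurableSet_tailSide _ _ _ _ _ _ _ _

theorem pow_le_mul_of_mem_Ioc_div {K d q : ℕ} (hq : q ∈ Finset.Ioc (K ^ d / (2 * 4 ^ d)) (K ^ d)) :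
    (K : ℝ) ^ d ≤ 2 * 4 ^ d * q := by
  have h := (Nat.div_lt_iff_lt_mul (by positivity)).1 (Finset.mem_Ioc.1 hq).1
  have : K ^ d ≤ 2 * 4 ^ d * q := by rw [mul_comm]; exact h.le
  exact_mod_cast this

theorem log_le_of_mem_Ioc {K d q : ℕ} (hq : q ∈ Finset.Ioc (K ^ d / (2 * 4 ^ d)) (K ^ d)) :
    Real.log q ≤ d * Real.log K := by
  obtain ⟨h1, h2⟩ := Finset.mem_Ioc.1 hq
  rw [← Real.log_pow]
  have h0 : 0 < q := (Nat.zero_le _).trans_lt h1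
  exact Real.log_le_log (by exact_mod_cast h0) (by exact_mod_cast h2)

/-- Fubini in the first coordinate: over each point of the Dirichlet set, with denominator `q`, the
section contains `headSide` for the same `q`, whose measure is bounded below uniformly in `q`. -/
theorem le_volume_largeSet {κ : ℝ} {N d K M₁ M₂ : ℕ} (hd : d ≤ N) (hκ : 0 < κ) (hK : 2 ≤ K)
    (hM₁ : κ * (K : ℝ) ^ 2 / 2 ≤ M₁) (hM₂ : κ * ((K : ℝ) ^ 3 * K ^ d) / 2 ≤ M₂) (hM₂1 : 1 ≤ M₂) :
    ENNReal.ofReal (κ ^ 2 * Real.pi / (2 * 4 ^ d) * (κ * Real.pi) ^ d / 2 *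
        (((K : ℝ) ^ 4 * (K ^ d) ^ 2) ^ (d + 1) * ((K : ℝ) ^ 2 * K ^ d) ^ (N - d)) /
          (1 + 2 * (d * Real.log K))) ≤ volume (largeSet κ N d K M₁ M₂) := by
  have hpi := Real.pi_pos
  have hK1 : (1 : ℝ) ≤ K := by exact_mod_cast (by omega : 1 ≤ K)
  have hK0 : (0 : ℝ) < K := by linarith
  have hlogK : 0 ≤ Real.log K := Real.log_nonneg hK1
  set r := 2 * Real.pi * ((K : ℝ) * K ^ d) with hr
  set s := (K : ℝ) ^ 2 * K ^ d with hs
  have hr0 : 0 < r := by positivity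
  have hs0 : 0 < s := by positivity
  have hG := half_le_volume_iUnion_tailSide hd hK hM₂1 hr0 hs0
  set G := ⋃ q ∈ Finset.Ioc (K ^ d / (2 * 4 ^ d)) (K ^ d),
    Set.univ.pi (tailSide N d r s M₂ K q) with hGdef
  have hGm : MeasurableSet G := Finset.measurableSet_biUnion _ fun q _ =>
    MeasurableSet.univ_pi fun i => measurableSet_tailSide _ _ _ _ _ _ _ _
  rw [volume_eq_volume_preimage_toLp (measurableSet_largeSet _ _ _ _ _ _)]
  set v := ENNReal.ofReal (κ ^ 2 * Real.pi / (2 * 4 ^ d) * ((K : ℝ) ^ 4 * (K ^ d) ^ 2) /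
    (1 + 2 * (d * Real.log K))) with hv
  have hsec := mul_le_volume_of_section (v := v)
    ((measurableSet_largeSet κ N d K M₁ M₂).preimage
      (PiLp.volume_preserving_toLp (Fin (N + 1))).measurable) hGm ?_
  · refine le_trans ?_ hsec
    refine le_trans ?_ (mul_le_mul_right hG v)
    rw [hv, ← ENNReal.ofReal_mul (by positivity)]
    apply ENNReal.ofReal_le_ofReal
    have h1 : κ * Real.pi * ((K : ℝ) ^ 4 * (K ^ d) ^ 2) ≤ r * M₂ := by
      calc κ * Real.pi * ((K : ℝ) ^ 4 * (K ^ d) ^ 2)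
          = r * (κ * ((K : ℝ) ^ 3 * K ^ d) / 2) := by rw [hr]; ring
        _ ≤ _ := by gcongr
    calc _ = κ ^ 2 * Real.pi / (2 * 4 ^ d) * ((K : ℝ) ^ 4 * (K ^ d) ^ 2) /
          (1 + 2 * (d * Real.log K)) *
          ((κ * Real.pi * ((K : ℝ) ^ 4 * (K ^ d) ^ 2)) ^ d * s ^ (N - d) / 2) := by
          rw [pow_succ, mul_pow (κ * Real.pi)]; ring
      _ ≤ _ := by gcongr
  · intro z hz
    simp only [hGdef, Set.mem_iUnion] at hz
    obtain ⟨q, hq, hz⟩ := hz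
    have hq0 : 0 < q := (Nat.zero_le _).trans_lt (Finset.mem_Ioc.1 hq).1
    refine le_trans (le_volume_headSide (Q := (K : ℝ) ^ d) (D := 4 ^ d) hκ hK1
      (one_le_pow₀ (by norm_num)) hq0 (by exact_mod_cast (Finset.mem_Ioc.1 hq).2)
      (pow_le_mul_of_mem_Ioc_div hq) (by linarith [log_le_of_mem_Ioc hq]) hM₁) (measure_mono ?_)
    intro y hy
    change WithLp.toLp 2 (Fin.cons y z : Fin (N + 1) → ℝ) ∈ largeSet κ N d K M₁ M₂
    simp only [largeSet, Set.mem_iUnion]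
    refine ⟨q, hq, fun i => ?_⟩
    refine Fin.cases ?_ (fun i => ?_) i
    · simpa using hy
    · simpa using hz i trivial

theorem measurableSet_freqSide (κ k Q : ℝ) (N d L : ℕ) (i : Fin (N + 1)) :
    MeasurableSet (freqSide κ k Q N d L i) := by
  refine Fin.cases ?_ (fun i => ?_) i
  · exact measurableSet_Ioc
  · simp only [freqSide, Fin.cons_succ]
    split_ifs
    · exact measurableSet_comb _ _ _
    · exact measurableSet_Ioc

theorem div_le_one_div_of_one_le {κ k Q : ℝ} (hκ : κ ≤ 1) (hk : 1 ≤ k) (hQ : 1 ≤ Q) :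
    κ / (k ^ 4 * Q ^ 2) ≤ 1 / (k * Q) := by
  gcongr
  · exact le_self_pow₀ hk (by norm_num)
  · exact le_self_pow₀ hQ (by norm_num)

theorem volume_real_box_freqSide {κ k Q : ℝ} {N d L : ℕ} (hd : d ≤ N) (hκ0 : 0 ≤ κ) (hκ : κ ≤ 1)
    (hk : 1 ≤ k) (hQ : 1 ≤ Q) :
    volume.real (box (freqSide κ k Q N d L)) = κ / (k ^ 2 * Q) *
      ((L * (κ / (k ^ 4 * Q ^ 2))) ^ d * (κ / (k ^ 2 * Q)) ^ (N - d)) := by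
  rw [measureReal_def, volume_box (measurableSet_freqSide _ _ _ _ _ _), Fin.prod_univ_succ]
  simp only [freqSide, Fin.cons_zero, Fin.cons_succ, apply_ite volume]
  rw [volume_comb (by positivity) (div_le_one_div_of_one_le hκ hk hQ), prod_ite_val_lt hd,
    Real.volume_Ioc, Real.volume_Ioc]
  simp only [zero_add, sub_zero, add_sub_cancel_left, ENNReal.toReal_mul, ENNReal.toReal_pow]
  rw [ENNReal.toReal_ofReal (by positivity), ENNReal.toReal_ofReal (by positivity)]

theorem box_freqSide_subset_ball {κ k Q : ℝ} {N d L : ℕ} (hκ0 : 0 < κ)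
    (hκ : κ * (N + 1) ≤ 1 / 100) (hk : 1 ≤ k) (hQ : 1 ≤ Q) (hL : L ≤ κ * (k * Q)) :
    box (freqSide κ k Q N d L) ⊆ Metric.ball 0 1 := by
  have hN : (0 : ℝ) ≤ N := by positivity
  have hκ1 : κ ≤ 1 := by nlinarith
  have ha : κ / (k ^ 2 * Q) ≤ κ := div_le_self hκ0.le
    (one_le_mul_of_one_le_of_one_le (one_le_pow₀ hk) hQ)
  have ha0 : 0 < κ / (k ^ 2 * Q) := by positivity
  intro ξ hξ
  rw [mem_ball_zero_iff]
  refine lt_of_le_of_lt (norm_le_card_mul_of_forall_abs_le (c := 2 * κ) (by positivity) ?_) ?_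
  · intro i
    have h := hξ i
    revert h
    refine Fin.cases ?_ (fun i => ?_) i
    · simp only [freqSide, Fin.cons_zero, Set.mem_Ioc]
      rintro ⟨h1, h2⟩
      rw [abs_le]; constructor <;> linarith
    · simp only [freqSide, Fin.cons_succ]
      split_ifs
      · simp only [comb, Set.mem_iUnion, Set.mem_Ioc, Finset.mem_range]
        rintro ⟨ℓ, hℓ, h1, h2⟩
        have h3 : (ℓ : ℝ) + 1 ≤ L := by exact_mod_cast hℓ
        have h4 := div_le_one_div_of_one_le hκ1 hk hQ
        have h5 : 0 ≤ 1 / (k * Q) * (ℓ : ℝ) := by positivity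
        have h6 : 1 / (k * Q) * ((ℓ : ℝ) + 1) ≤ κ := by
          calc 1 / (k * Q) * ((ℓ : ℝ) + 1) ≤ 1 / (k * Q) * (κ * (k * Q)) := by
                gcongr; linarith
            _ = κ := by field_simp
        rw [abs_le]; constructor <;> linarith
      · simp only [Set.mem_Ioc]
        rintro ⟨h1, h2⟩
        rw [abs_le]; constructor <;> linarith
  · push_cast; linarith

/-- The centres of the balls are the positions `-2 κ t` of the packet of frequency `κ` at the Gauss
sum times `t`, so the first coordinate determines the time to use. -/
theorem exists_of_mem_headSide {κ k Q : ℝ} {M q : ℕ} {y : ℝ} (h : y ∈ headSide κ k Q M q) :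
    ∃ b : ℕ, 1 ≤ b ∧ b ≤ q * M ∧ q.Coprime b ∧
      |y + 2 * κ * (Real.pi * (parityFactor q * b : ℕ) * (k * Q) ^ 2 / q)| <
        κ * Real.pi * (k ^ 2 * Q) := by
  simp only [headSide, Set.mem_iUnion, Finset.mem_filter, Finset.mem_Ico] at h
  obtain ⟨b, ⟨⟨h1, h2⟩, h3⟩, h4⟩ := h
  refine ⟨b, h1, by omega, h3, ?_⟩
  rw [Metric.mem_ball, Real.dist_eq] at h4
  convert h4 using 2
  push_cast; ring

theorem focusTime_bounds {κ k Q : ℝ} {M q b : ℕ} (hκ : κ ≤ 1 / 100) (hk : 1 ≤ k)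
    (hQ : 1 ≤ Q) (hq : 0 < q) (hM : M ≤ κ * k ^ 2) (hb : 1 ≤ b) (hbq : b ≤ q * M) :
    0 < Real.pi * (parityFactor q * b : ℕ) * (k * Q) ^ 2 / q ∧
      Real.pi * (parityFactor q * b : ℕ) * (k * Q) ^ 2 / q ≤ k ^ 4 * Q ^ 2 / 10 := by
  have hpi := Real.pi_pos
  have hpi4 := Real.pi_le_four
  have hq0 : (0 : ℝ) < q := by exact_mod_cast hq
  have hb0 : (1 : ℝ) ≤ b := by exact_mod_cast hb
  have hb1 : (b : ℝ) ≤ q * M := by exact_mod_cast hbq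
  have he := one_le_parityFactor q
  have he2 : (parityFactor q : ℝ) ≤ 2 := by exact_mod_cast parityFactor_le_two q
  constructor
  · have : 0 < parityFactor q * b := by positivity
    have : (0 : ℝ) < (parityFactor q * b : ℕ) := by exact_mod_cast this
    positivity
  · push_cast
    calc Real.pi * (parityFactor q * b) * (k * Q) ^ 2 / q
        ≤ 4 * (2 * (q * (1 / 100 * k ^ 2))) * (k * Q) ^ 2 / q := by
          gcongr
          exact hb1.trans (by gcongr; exact hM.trans (by gcongr))
      _ = 8 / 100 * (k ^ 4 * Q ^ 2) := by field_simp; ring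
      _ ≤ _ := by nlinarith [show 0 ≤ k ^ 4 * Q ^ 2 by positivity]

theorem pow_mul_pow_le_prod {N d : ℕ} (hd : d ≤ N) {α β : ℝ} (hα : 0 ≤ α) (hβ : 0 ≤ β)
    (F : Fin N → ℝ) (h : ∀ i : Fin N, (if (i : ℕ) < d then α else β) ≤ F i) :
    α ^ d * β ^ (N - d) ≤ ∏ i, F i := by
  rw [← prod_ite_val_lt hd]
  refine Finset.prod_le_prod (fun i _ => ?_) fun i _ => h i
  split_ifs <;> assumption

/-- At each point of the large set, for some time there is only square root cancellation in each of
the `d` directions of the combs and none in the others. -/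
theorem exists_time_le_norm_integral {κ : ℝ} {N d K L M₁ M₂ : ℕ} (hd : d ≤ N) (hκ : 0 < κ)
    (hκD : κ * 4 ^ d ≤ 1 / 100) (hK : 3 ≤ K)
    (hM₁ : M₁ ≤ κ * (K : ℝ) ^ 2) (hM₂ : M₂ ≤ κ * ((K : ℝ) ^ 3 * K ^ d))
    (hL : L ≤ κ * ((K : ℝ) * K ^ d)) (hlog : (K : ℝ) ^ d * (2 * (1 + d * Real.log K)) ≤ L / 4)
    {x : Rn (N + 1)} (hx : x ∈ largeSet κ N d K M₁ M₂) :
    ∃ t ∈ Set.Ioc (0 : ℝ) ((K : ℝ) ^ 4 * (K ^ d) ^ 2),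
      volume.real (box (freqSide κ K (K ^ d) N d L)) *
          (((1 : ℝ) / 4) ^ (N + 1) * (Real.sqrt (K ^ d))⁻¹ ^ d) ≤
        ‖∫ ξ in box (freqSide κ K (K ^ d) N d L),
          Complex.exp (Complex.I * ((inner ℝ x ξ + t * ‖ξ‖ ^ 2 : ℝ) : ℂ))‖ := by
  have hpi := Real.pi_pos
  have hpi4 := Real.pi_le_four
  have hk3 : (3 : ℝ) ≤ K := by exact_mod_cast hK
  have hk1 : (1 : ℝ) ≤ K := by linarith
  have hD1 : (1 : ℝ) ≤ 4 ^ d := one_le_pow₀ (by norm_num)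
  have hκ1 : κ ≤ 1 / 100 := by nlinarith
  set k : ℝ := (K : ℝ) with hk
  set Q : ℝ := k ^ d with hQ
  have hQ1 : 1 ≤ Q := one_le_pow₀ hk1
  simp only [largeSet, Set.mem_iUnion] at hx
  obtain ⟨q, hq, hx⟩ := hx
  have hq0 : 0 < q := (Nat.zero_le _).trans_lt (Finset.mem_Ioc.1 hq).1
  have hqQ : (q : ℝ) ≤ Q := by
    rw [hQ, hk]; exact_mod_cast (Finset.mem_Ioc.1 hq).2
  have hq1 : (1 : ℝ) ≤ q := by exact_mod_cast hq0
  obtain ⟨b, hb1, hbM, hcop, hhead⟩ := exists_of_mem_headSide (by simpa using hx 0)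
  obtain ⟨ht0, ht1⟩ := focusTime_bounds hκ1 hk1 hQ1 hq0 hM₁ hb1 hbM
  set t := Real.pi * (parityFactor q * b : ℕ) * (k * Q) ^ 2 / q with ht
  have hR0 : 0 < k ^ 4 * Q ^ 2 := by positivity
  have htR : t ≤ k ^ 4 * Q ^ 2 := by linarith
  refine ⟨t, ⟨ht0, htR⟩, ?_⟩
  rw [integral_box_eq_prod, norm_prod, volume_real_box_freqSide hd hκ.le (by linarith) hk1 hQ1,
    Fin.prod_univ_succ]
  set a₀ := κ / (k ^ 2 * Q) with ha₀
  set w := κ / (k ^ 4 * Q ^ 2) with hw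
  set S := (Real.sqrt Q)⁻¹ with hS
  have hS0 : 0 < S := by
    have := Real.sqrt_pos.2 (show 0 < Q by linarith)
    positivity
  have hfirst : a₀ / 4 ≤ ‖∫ s in freqSide κ k Q N d L 0, osc (x 0) t s‖ := by
    refine le_trans ?_ (le_norm_integral_wavePacket (c := κ) hκ hκ1 hk1 hQ1 ht0.le htR ?_)
    · have : 0 < a₀ := by positivity
      linarith
    · refine hhead.le.trans ?_
      have : κ * Real.pi ≤ 1 := by nlinarith
      calc κ * Real.pi * (k ^ 2 * Q) ≤ 1 * (k ^ 2 * Q) := by gcongr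
        _ = _ := one_mul _
  -- The comb directions contribute `L w S / 4`, with Gauss sum loss `S`, and the remaining ones `a₀
  -- / 4`; all use the time chosen by the first coordinate.
  have hrest := pow_mul_pow_le_prod hd (α := L * w * S / 4) (β := a₀ / 4) (by positivity)
    (by positivity) (fun i : Fin N => ‖∫ s in freqSide κ k Q N d L i.succ, osc (x i.succ) t s‖) ?_
  · calc a₀ * ((L * w) ^ d * a₀ ^ (N - d)) * ((1 / 4) ^ (N + 1) * S ^ d)
        = a₀ / 4 * ((L * w * S / 4) ^ d * (a₀ / 4) ^ (N - d)) := by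
          have : ((1 : ℝ) / 4) ^ (N + 1) = 1 / 4 * ((1 / 4) ^ d * (1 / 4) ^ (N - d)) := by
            rw [← pow_add, pow_succ', Nat.add_sub_cancel' hd]
          rw [this, div_eq_mul_one_div (L * w * S), div_eq_mul_one_div a₀, mul_pow (L * w * S),
            mul_pow (L * w), mul_pow a₀]
          ring
      _ ≤ _ := by gcongr
  · intro i
    have hxi : x i.succ ∈ tailSide N d (2 * Real.pi * (k * Q)) (k ^ 2 * Q) M₂ K q i := by
      simpa using hx i.succ
    simp only [freqSide, Fin.cons_succ]
    unfold tailSide at hxi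
    split_ifs at hxi ⊢ with h
    · obtain ⟨⟨hx0, hx1⟩, a, ha⟩ := hxi
      refine le_trans ?_ (le_norm_integral_comb_of_nearRational (D := 4 ^ d) (a := a) hκ hD1 hκD
        hk3 hq0 hqQ (pow_le_mul_of_mem_Ioc_div hq) hL ?_ ht0.le htR (by rw [ht]; push_cast; ring)
        (even_parityFactor_mul q b) (isCoprime_parityFactor_mul hcop) hx0.le ?_ ha)
      · have : S ≤ (Real.sqrt q)⁻¹ := by
          rw [hS]
          have := Real.sqrt_pos.2 (show (0 : ℝ) < q by linarith)
          gcongr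
        gcongr
      · refine le_trans ?_ hlog
        have := Real.log_nonneg hq1
        gcongr
        exact log_le_of_mem_Ioc hq
      · refine hx1.trans ?_
        calc 2 * Real.pi * (k * Q) * M₂ ≤ 2 * 4 * (k * Q) * (1 / 100 * (k ^ 3 * Q)) := by
              gcongr
              exact hM₂.trans (by gcongr)
          _ = 8 / 100 * (k ^ 4 * Q ^ 2) := by ring
          _ ≤ _ := by linarith
    · refine le_trans ?_ (le_norm_integral_wavePacket (c := 0) hκ hκ1 hk1 hQ1 ht0.le htR ?_)
      · have : 0 < a₀ := by positivity
        linarith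
      · simp only [mul_zero, zero_mul, add_zero]
        rw [abs_of_pos hxi.1]; exact hxi.2

theorem largeSet_subset_ball {κ : ℝ} {N d K M₁ M₂ : ℕ} (hκ : 0 < κ)
    (hκN : κ * (N + 1) ≤ 1 / 100) (hK : 100 * (N + 1) ≤ K)
    (hM₁ : M₁ ≤ κ * (K : ℝ) ^ 2) (hM₂ : M₂ ≤ κ * ((K : ℝ) ^ 3 * K ^ d)) :
    largeSet κ N d K M₁ M₂ ⊆ Metric.ball 0 ((K : ℝ) ^ 4 * (K ^ d) ^ 2) := by
  have hpi := Real.pi_pos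
  have hpi4 := Real.pi_le_four
  have hN : (0 : ℝ) ≤ N := by positivity
  have hk : 100 * ((N : ℝ) + 1) ≤ K := by exact_mod_cast hK
  have hk1 : (1 : ℝ) ≤ K := by linarith
  have hκ1 : κ ≤ 1 / 100 := by nlinarith
  intro x hx
  set k : ℝ := (K : ℝ) with hkdef
  set Q : ℝ := k ^ d with hQ
  have hQ1 : 1 ≤ Q := one_le_pow₀ hk1
  simp only [largeSet, Set.mem_iUnion] at hx
  obtain ⟨q, hq, hx⟩ := hx
  have hq0 : 0 < q := (Nat.zero_le _).trans_lt (Finset.mem_Ioc.1 hq).1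
  obtain ⟨b, hb1, hbM, hcop, hhead⟩ := exists_of_mem_headSide (by simpa using hx 0)
  obtain ⟨ht0, ht1⟩ := focusTime_bounds hκ1 hk1 hQ1 hq0 hM₁ hb1 hbM
  set R := k ^ 4 * Q ^ 2 with hR
  have hR0 : 0 < R := by positivity
  have hs : k ^ 2 * Q ≤ R / (100 * (N + 1)) := by
    rw [le_div_iff₀ (by positivity), hR]
    have h1 : 100 * ((N : ℝ) + 1) ≤ k ^ 2 * Q :=
      calc 100 * ((N : ℝ) + 1) ≤ k := hk
        _ ≤ k ^ 2 := le_self_pow₀ hk1 (by norm_num)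
        _ ≤ k ^ 2 * Q := le_mul_of_one_le_right (by positivity) hQ1
    calc k ^ 2 * Q * (100 * (N + 1)) ≤ k ^ 2 * Q * (k ^ 2 * Q) :=
          mul_le_mul_of_nonneg_left h1 (by positivity)
      _ = k ^ 4 * Q ^ 2 := by ring
  have hκ2 : κ ≤ 1 / (100 * (N + 1)) := by
    rw [le_div_iff₀ (by positivity)]; linarith
  have hκR : κ * R ≤ R / (100 * (N + 1)) := by
    calc κ * R ≤ 1 / (100 * (N + 1)) * R := by gcongr
      _ = _ := by ring
  set T := R / (100 * ((N : ℝ) + 1)) with hT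
  have hT0 : 0 < T := by positivity
  rw [mem_ball_zero_iff]
  refine lt_of_le_of_lt (norm_le_card_mul_of_forall_abs_le (c := 10 * T) (by positivity) ?_) ?_
  · intro i
    refine Fin.cases ?_ (fun i => ?_) i
    · set t := Real.pi * (parityFactor q * b : ℕ) * (k * Q) ^ 2 / q with ht
      have h1 : κ * Real.pi * (k ^ 2 * Q) ≤ T := by
        have : κ * Real.pi ≤ 1 := by nlinarith
        calc κ * Real.pi * (k ^ 2 * Q) ≤ 1 * (k ^ 2 * Q) := by gcongr
          _ ≤ T := by linarith
      have h2 : 2 * κ * t ≤ T := by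
        calc 2 * κ * t ≤ 2 * κ * (R / 10) := by gcongr
          _ ≤ κ * R := by nlinarith
          _ ≤ T := hκR
      have h3 : 0 < 2 * κ * t := by positivity
      obtain ⟨h4, h5⟩ := abs_lt.1 hhead
      rw [abs_le]; constructor <;> linarith
    · have hxi : x i.succ ∈ tailSide N d (2 * Real.pi * (k * Q)) (k ^ 2 * Q) M₂ K q i := by
        simpa using hx i.succ
      unfold tailSide at hxi
      split_ifs at hxi with h
      · obtain ⟨⟨hx0, hx1⟩, -⟩ := hxi
        rw [abs_of_pos hx0]
        refine hx1.trans ?_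
        calc 2 * Real.pi * (k * Q) * M₂ ≤ 2 * 4 * (k * Q) * (κ * (k ^ 3 * Q)) := by gcongr
          _ = 8 * (κ * R) := by rw [hR]; ring
          _ ≤ _ := by linarith
      · rw [abs_of_pos hxi.1]
        linarith [hxi.2]
  · have : ((N : ℝ) + 1) * (10 * T) = R / 10 := by rw [hT]; field_simp; ring
    push_cast
    linarith

theorem half_le_floor {y : ℝ} (hy : 1 ≤ y) : y / 2 ≤ (⌊y⌋₊ : ℝ) := by
  have h1 := Nat.lt_floor_add_one y
  have h2 : (1 : ℝ) ≤ (⌊y⌋₊ : ℝ) := by exact_mod_cast (Nat.one_le_floor_iff _).2 hy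
  linarith

/-- The example: initial data whose maximal function is large on a large set. -/
theorem exists_le_maximalFunction (N d : ℕ) (hd : d ≤ N) :
    ∃ c : ℝ, 0 < c ∧ ∀ᶠ K : ℕ in Filter.atTop, ∃ (f : L2 (N + 1)) (S : Set (Rn (N + 1))),
      FourierSupportedInUnitBall f ∧ 0 < ‖f‖ ∧ MeasurableSet S ∧
      S ⊆ Metric.ball 0 ((K : ℝ) ^ 4 * (K ^ d) ^ 2) ∧
      ENNReal.ofReal (c * (((K : ℝ) ^ 4 * (K ^ d) ^ 2) ^ (d + 1) *
        ((K : ℝ) ^ 2 * K ^ d) ^ (N - d)) / (1 + 2 * (d * Real.log K))) ≤ volume S ∧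
      ∀ x ∈ S, ENNReal.ofReal (c * Real.sqrt ((((K : ℝ) ^ 2 * K ^ d) ^ (N - d + 1))⁻¹ *
        (((K : ℝ) ^ 3 * K ^ d) ^ d)⁻¹ * (((K : ℝ) ^ d) ^ d)⁻¹) * ‖f‖) ≤
          maximalFunction ((K : ℝ) ^ 4 * (K ^ d) ^ 2) f x := by
  have hpi := Real.pi_pos
  -- The factor `4 ^ d` controls the phase accumulated along the combs, the factor `N + 1` keeps
  -- frequencies in the unit ball and the large set in `B(0,R)`.
  set κ : ℝ := 1 / (100 * (N + 1) * 4 ^ d) with hκdef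
  have hκ : 0 < κ := by positivity
  have hD1 : (1 : ℝ) ≤ 4 ^ d := one_le_pow₀ (by norm_num)
  have hN0 : (0 : ℝ) ≤ N := by positivity
  have hκD : κ * 4 ^ d ≤ 1 / 100 := by
    have : κ * 4 ^ d = 1 / 100 / (N + 1) := by rw [hκdef]; field_simp
    rw [this]; exact div_le_self (by norm_num) (by linarith)
  have hκN : κ * (N + 1) ≤ 1 / 100 := by
    have : κ * (N + 1) = 1 / 100 / 4 ^ d := by rw [hκdef]; field_simp
    rw [this]; exact div_le_self (by norm_num) hD1
  have hκ1 : κ ≤ 1 / 100 := by nlinarith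
  set c₁ : ℝ := κ ^ 2 * Real.pi / (2 * 4 ^ d) * (κ * Real.pi) ^ d / 2 with hc₁
  set c₂ : ℝ := Real.sqrt (((2 * Real.pi) ^ (N + 1))⁻¹ * (κ ^ (N - d + 1) * (κ ^ 2 / 2) ^ d)) *
    (1 / 4) ^ (N + 1) with hc₂
  have hc₁0 : 0 < c₁ := by positivity
  have hc₂0 : 0 < c₂ := by positivity
  refine ⟨min c₁ c₂, lt_min hc₁0 hc₂0, ?_⟩
  -- The extra factor `K` in the number of teeth makes the main term, of order `K Q`, dominate the
  -- Gauss sum error, of order `Q log K`.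
  have hev : ∀ᶠ K : ℕ in Filter.atTop, 16 * (1 + d * Real.log K) ≤ κ * K := by
    have h1 : Filter.Tendsto (fun x : ℝ => (1 + d * Real.log x) / x) Filter.atTop (nhds 0) := by
      have ha := (Real.isLittleO_log_id_atTop.const_mul_left (d : ℝ)).tendsto_div_nhds_zero
      have hb : Filter.Tendsto (fun x : ℝ => x⁻¹) Filter.atTop (nhds 0) := tendsto_inv_atTop_zero
      have := hb.add ha
      simp only [add_zero, id] at this
      refine this.congr fun x => ?_
      rw [add_div, one_div]
    have h2 := (h1.comp tendsto_natCast_atTop_atTop).eventually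
      (gt_mem_nhds (show (0 : ℝ) < κ / 16 by positivity))
    filter_upwards [h2, Filter.eventually_gt_atTop 0] with K hK hK0
    have hK0' : (0 : ℝ) < K := by exact_mod_cast hK0
    simp only [Function.comp_apply] at hK
    rw [div_lt_iff₀ hK0'] at hK
    linarith
  filter_upwards [hev, Filter.eventually_ge_atTop (100 * (N + 1))] with K hlogK hKN
  have hK3 : 3 ≤ K := by omega
  have hk1 : (1 : ℝ) ≤ K := by exact_mod_cast (by omega : 1 ≤ K)
  have hlog0 : 0 ≤ Real.log K := Real.log_nonneg hk1
  have hdlog : 0 ≤ d * Real.log K := by positivity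
  set k : ℝ := (K : ℝ) with hk
  set Q : ℝ := k ^ d with hQ
  have hQ1 : 1 ≤ Q := one_le_pow₀ hk1
  have hκk : 16 ≤ κ * k := by linarith
  have hy₁ : 1 ≤ κ * k ^ 2 := by nlinarith
  have hy₂ : 1 ≤ κ * (k * Q) := by nlinarith
  have hy₃ : 1 ≤ κ * (k ^ 3 * Q) := by
    calc (1 : ℝ) ≤ κ * (k * Q) := hy₂
      _ ≤ κ * (k ^ 3 * Q) := by gcongr; exact le_self_pow₀ hk1 (by norm_num)
  set M₁ := ⌊κ * k ^ 2⌋₊ with hM₁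
  set M₂ := ⌊κ * (k ^ 3 * Q)⌋₊ with hM₂
  set L := ⌊κ * (k * Q)⌋₊ with hL
  have hM₁u : (M₁ : ℝ) ≤ κ * k ^ 2 := Nat.floor_le (by positivity)
  have hM₂u : (M₂ : ℝ) ≤ κ * (k ^ 3 * Q) := Nat.floor_le (by positivity)
  have hLu : (L : ℝ) ≤ κ * (k * Q) := Nat.floor_le (by positivity)
  have hM₁l := half_le_floor hy₁
  have hM₂l := half_le_floor hy₃
  have hLl := half_le_floor hy₂
  have hlogL : Q * (2 * (1 + d * Real.log K)) ≤ L / 4 := by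
    have : Q * (16 * (1 + d * Real.log K)) ≤ Q * (κ * k) := by gcongr
    nlinarith
  set Ω := box (freqSide κ k Q N d L) with hΩ
  have hΩm : MeasurableSet Ω := measurableSet_box (measurableSet_freqSide _ _ _ _ _ _)
  obtain ⟨f, hf, hfn, hfs⟩ := exists_schrodinger_eq_integral hΩm
    (box_freqSide_subset_ball hκ hκN hk1 hQ1 hLu)
  have hvol := volume_real_box_freqSide (L := L) hd hκ.le (by linarith) hk1 hQ1
  rw [← hΩ] at hvol
  have hvl : κ ^ (N - d + 1) * (κ ^ 2 / 2) ^ d *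
      (((k ^ 2 * Q) ^ (N - d + 1))⁻¹ * ((k ^ 3 * Q) ^ d)⁻¹) ≤ volume.real Ω := by
    rw [hvol]
    have h1 : κ ^ 2 / 2 * (k ^ 3 * Q)⁻¹ ≤ L * (κ / (k ^ 4 * Q ^ 2)) := by
      calc κ ^ 2 / 2 * (k ^ 3 * Q)⁻¹ = κ * (k * Q) / 2 * (κ / (k ^ 4 * Q ^ 2)) := by field_simp
        _ ≤ _ := by gcongr
    calc κ ^ (N - d + 1) * (κ ^ 2 / 2) ^ d * (((k ^ 2 * Q) ^ (N - d + 1))⁻¹ * ((k ^ 3 * Q) ^ d)⁻¹)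
        = κ / (k ^ 2 * Q) *
          ((κ ^ 2 / 2 * (k ^ 3 * Q)⁻¹) ^ d * (κ / (k ^ 2 * Q)) ^ (N - d)) := by
          rw [mul_pow (κ ^ 2 / 2), div_pow κ, inv_pow, pow_succ, pow_succ]; field_simp; ring
      _ ≤ _ := by gcongr
  set U := ((k ^ 2 * Q) ^ (N - d + 1))⁻¹ * ((k ^ 3 * Q) ^ d)⁻¹ with hU
  have hU0 : 0 < U := by positivity
  have hv0 : 0 < volume.real Ω := lt_of_lt_of_le (by positivity) hvl
  refine ⟨f, largeSet κ N d K M₁ M₂, hf, ?_, measurableSet_largeSet _ _ _ _ _ _,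
    largeSet_subset_ball hκ hκN hKN hM₁u hM₂u, ?_, fun x hx => ?_⟩
  · rw [hfn]; positivity
  · refine le_trans (ENNReal.ofReal_le_ofReal ?_)
      (le_volume_largeSet hd hκ (by omega) hM₁l hM₂l ((Nat.one_le_floor_iff _).2 hy₃))
    gcongr
    exact min_le_left _ _
  · obtain ⟨t, ht, hlow⟩ := exists_time_le_norm_integral hd hκ hκD hK3 hM₁u hM₂u hLu hlogL hx
    refine le_trans ?_ (le_iSup₂ (f := fun t _ => ‖schrodinger t f x‖ₑ) t ht)
    rw [← ofReal_norm, hfs]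
    apply ENNReal.ofReal_le_ofReal
    set A := ((2 * Real.pi) ^ (N + 1))⁻¹ with hA
    have hA0 : 0 < A := by positivity
    have hsq : (Real.sqrt Q)⁻¹ ^ d = Real.sqrt ((Q ^ d)⁻¹) := by
      rw [Real.sqrt_inv, inv_pow]
      congr 1
      exact (Real.sqrt_eq_iff_mul_self_eq (by positivity) (by positivity)).2 (by
        rw [← mul_pow, Real.mul_self_sqrt (by linarith)]) |>.symm
    -- As `‖f‖² = A |Ω|`, the lower bound `A |Ω| Q^{-d/2}` is `‖f‖` times `(A |Ω|)^{1/2} Q^{-d/2}`.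
    have h3 : c₂ * Real.sqrt (U * (Q ^ d)⁻¹) ≤
        Real.sqrt (A * volume.real Ω) * ((1 / 4) ^ (N + 1) * (Real.sqrt Q)⁻¹ ^ d) := by
      rw [hsq, Real.sqrt_mul hU0.le]
      calc c₂ * (Real.sqrt U * Real.sqrt ((Q ^ d)⁻¹))
          = Real.sqrt (A * (κ ^ (N - d + 1) * (κ ^ 2 / 2) ^ d * U)) *
            ((1 / 4) ^ (N + 1) * Real.sqrt ((Q ^ d)⁻¹)) := by
            rw [hc₂, ← mul_assoc A _ U, Real.sqrt_mul (by positivity) U]; ring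
        _ ≤ _ := by gcongr
    calc min c₁ c₂ * Real.sqrt (U * (Q ^ d)⁻¹) * ‖f‖
        ≤ c₂ * Real.sqrt (U * (Q ^ d)⁻¹) * ‖f‖ := by gcongr; exact min_le_right _ _
      _ ≤ (Real.sqrt (A * volume.real Ω) * ((1 / 4) ^ (N + 1) * (Real.sqrt Q)⁻¹ ^ d)) * ‖f‖ := by
          gcongr
      _ = A * (volume.real Ω * ((1 / 4) ^ (N + 1) * (Real.sqrt Q)⁻¹ ^ d)) := by
          rw [hfn]
          have := Real.mul_self_sqrt (show 0 ≤ A * volume.real Ω by positivity)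
          linear_combination ((1 / 4) ^ (N + 1) * (Real.sqrt Q)⁻¹ ^ d) * this
      _ ≤ _ := by gcongr

/-! ### Comparison of powers of `K`. -/

theorem eventually_one_add_log_lt (d : ℕ) {a δ : ℝ} (ha : 0 < a) (hδ : 0 < δ) :
    ∀ᶠ K : ℕ in Filter.atTop, 1 + 2 * (d * Real.log K) < δ * (K : ℝ) ^ a := by
  have h1 : Filter.Tendsto (fun x : ℝ => (1 + 2 * (d * Real.log x)) / x ^ a) Filter.atTop
      (nhds 0) := by
    have hl := ((isLittleO_log_rpow_atTop ha).const_mul_left (2 * d : ℝ)).tendsto_div_nhds_zero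
    have hb : Filter.Tendsto (fun x : ℝ => (x ^ a)⁻¹) Filter.atTop (nhds 0) :=
      (tendsto_rpow_atTop ha).inv_tendsto_atTop
    have := hb.add hl
    simp only [add_zero] at this
    refine this.congr fun x => ?_
    rw [add_div, one_div, mul_assoc]
  have h2 := (h1.comp tendsto_natCast_atTop_atTop).eventually (gt_mem_nhds hδ)
  filter_upwards [h2, Filter.eventually_gt_atTop 0] with K hK hK0
  have hK0' : (0 : ℝ) < K := by exact_mod_cast hK0
  simp only [Function.comp_apply] at hK
  rwa [div_lt_iff₀ (by positivity)] at hK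

theorem le_of_isAdmissible {N d : ℕ} (hd : d ≤ N) {p : ℝ≥0∞} (hp : 2 ≤ p) {γ : ℝ}
    (h : IsAdmissible (N + 1) p γ) :
    ((N + 1 : ℝ) + (d + 1)) / 2 * ((p⁻¹).toReal - 1 / 2) + (d + 1 : ℝ) / (2 * ((d + 1 : ℝ) + 1)) ≤
      γ := by
  set P := (p⁻¹).toReal with hP
  set τ := ((N + 1 : ℝ) + (d + 1)) / 2 * (P - 1 / 2) + (d + 1 : ℝ) / (2 * ((d + 1 : ℝ) + 1)) with hτ
  have hP0 : 0 ≤ P := ENNReal.toReal_nonneg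
  have hP1 : P ≤ 1 := by
    have : p⁻¹ ≤ 1 := ENNReal.inv_le_one.2 (le_trans (by norm_num) hp)
    exact ENNReal.toReal_le_of_le_ofReal zero_le_one (by simpa using this)
  have hp0 : p ≠ 0 := by rintro rfl; simp at hp
  by_contra! hlt
  -- Half of the gap pays for the loss `R ^ ε` in admissibility, the other half beats the logarithm.
  set ε := (τ - γ) / 2 with hε
  have hε0 : 0 < ε := by rw [hε]; linarith
  obtain ⟨C, hC, hadm⟩ := h ε hε0
  obtain ⟨c, hc, hex⟩ := exists_le_maximalFunction N d hd
  have hδ : 0 < c * c ^ P / C := by positivity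
  obtain ⟨K, ⟨f, S, hf, hf0, hSm, hSb, hSv, hmax⟩, hlog, hK2⟩ :=
    (hex.and ((eventually_one_add_log_lt d (a := (2 * d + 4) * ε) (by positivity) hδ).and
      (Filter.eventually_ge_atTop 2))).exists
  have hk2 : (2 : ℝ) ≤ K := by exact_mod_cast hK2
  set k : ℝ := (K : ℝ) with hk
  have hk0 : 0 < k := by linarith
  have hlog0 : 0 ≤ Real.log k := Real.log_nonneg (by linarith)
  set Λ := 1 + 2 * (d * Real.log k) with hΛ
  have hΛ1 : 1 ≤ Λ := by
    have : 0 ≤ 2 * (d * Real.log k) := by positivity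
    linarith
  set V := (k ^ 4 * (k ^ d) ^ 2) ^ (d + 1) * (k ^ 2 * k ^ d) ^ (N - d) with hV
  set U := ((k ^ 2 * k ^ d) ^ (N - d + 1))⁻¹ * ((k ^ 3 * k ^ d) ^ d)⁻¹ * ((k ^ d) ^ d)⁻¹ with hU
  set R := k ^ 4 * (k ^ d) ^ 2 with hR
  have hR1 : 1 < R := by
    have h1 : 1 < k ^ 4 := one_lt_pow₀ (by linarith) (by norm_num)
    have h2 : 1 ≤ (k ^ d) ^ 2 := one_le_pow₀ (one_le_pow₀ (by linarith))
    exact one_lt_mul_of_lt_of_le h1 h2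
  have hb0 : 0 < c * V / Λ := by positivity
  have hmain : c * Real.sqrt U * (c * V / Λ) ^ P ≤ C * R ^ ε * R ^ γ := by
    have hS0 : volume S ≠ 0 := by
      intro h0
      rw [h0] at hSv
      exact absurd hSv (not_le.2 (ENNReal.ofReal_pos.2 hb0))
    have h1 := (eLpNorm_ge_of_le_on hp0 hSm hSb hS0 hmax).trans (hadm R hR1 f hf)
    have h2 : ENNReal.ofReal (c * Real.sqrt U * ‖f‖ * (c * V / Λ) ^ P) ≤
        ENNReal.ofReal (C * R ^ ε * R ^ γ * ‖f‖) := by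
      refine le_trans ?_ h1
      rw [ENNReal.ofReal_mul (by positivity), ← ENNReal.ofReal_rpow_of_nonneg hb0.le hP0]
      gcongr
    rw [ENNReal.ofReal_le_ofReal_iff (by positivity)] at h2
    have h3 : c * Real.sqrt U * (c * V / Λ) ^ P * ‖f‖ ≤ C * R ^ ε * R ^ γ * ‖f‖ := by
      linarith
    exact le_of_mul_le_mul_right h3 hf0
  have hNd : ((N - d : ℕ) : ℝ) = N - d := Nat.cast_sub hd
  have hVk : V = k ^ ((2 * d + 4) * (d + 1) + (d + 2) * (N - d) : ℝ) := by
    have : V = k ^ ((2 * d + 4) * (d + 1) + (d + 2) * (N - d)) := by rw [hV, hR]; ring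
    rw [this, ← Real.rpow_natCast]
    congr 1
    push_cast [hNd]; ring
  have hUk : Real.sqrt U =
      k ^ (-((d + 2) * (N - d + 1) + (d + 3) * d + d * d : ℝ) / 2) := by
    have : U = (k ^ ((d + 2) * (N - d + 1) + (d + 3) * d + d * d))⁻¹ := by
      rw [hU, ← mul_inv, ← mul_inv]; congr 1; ring
    rw [Real.sqrt_eq_rpow, this, ← Real.rpow_natCast, ← Real.rpow_neg hk0.le,
      ← Real.rpow_mul hk0.le]
    congr 1
    push_cast [hNd]; ring
  have hRk : R = k ^ (2 * d + 4 : ℝ) := by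
    have : R = k ^ (2 * d + 4) := by rw [hR]; ring
    rw [this, ← Real.rpow_natCast]
    congr 1
    push_cast; ring
  -- The exponent count: `√U * V ^ P` is exactly `R ^ τ`, with `R = k ^ (2 d + 4)` and `τ = γ + 2
  -- ε`.
  have hτk : -((d + 2) * (N - d + 1) + (d + 3) * d + d * d : ℝ) / 2 +
      ((2 * d + 4) * (d + 1) + (d + 2) * (N - d) : ℝ) * P = (2 * d + 4) * (ε + γ + ε) := by
    have h1 : ε + γ + ε = τ := by rw [hε]; ring
    have : (d : ℝ) + 1 + 1 ≠ 0 := by positivity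
    rw [h1, hτ]
    field_simp
    ring
  -- Since `P ≤ 1` and `Λ ≥ 1`, one power of the logarithm suffices for every `p`.
  have hΛP : Λ ^ P ≤ Λ := by
    simpa using Real.rpow_le_rpow_of_exponent_le hΛ1 hP1
  rw [hUk, Real.div_rpow (by positivity) (by positivity), Real.mul_rpow hc.le (by positivity), hVk,
    hRk, ← Real.rpow_mul hk0.le, ← Real.rpow_mul hk0.le, ← Real.rpow_mul hk0.le] at hmain
  have h5 : c * c ^ P * (k ^ ((2 * d + 4) * (ε + γ)) * k ^ ((2 * d + 4) * ε)) ≤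
      C * k ^ ((2 * d + 4) * (ε + γ)) * Λ := by
    have h6 : k ^ ((2 * d + 4) * (ε + γ)) * k ^ ((2 * d + 4) * ε) =
        k ^ (-((d + 2) * (N - d + 1) + (d + 3) * d + d * d : ℝ) / 2) *
        k ^ (((2 * d + 4) * (d + 1) + (d + 2) * (N - d) : ℝ) * P) := by
      rw [← Real.rpow_add hk0, ← Real.rpow_add hk0, hτk]; ring_nf
    have h7 : k ^ ((2 * d + 4) * ε) * k ^ ((2 * d + 4) * γ) = k ^ ((2 * d + 4) * (ε + γ)) := by
      rw [← Real.rpow_add hk0]; ring_nf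
    rw [mul_assoc C, h7] at hmain
    rw [h6]
    have hΛP0 : 0 < Λ ^ P := by positivity
    calc c * c ^ P * (k ^ (-((d + 2) * (N - d + 1) + (d + 3) * d + d * d : ℝ) / 2) *
        k ^ (((2 * d + 4) * (d + 1) + (d + 2) * (N - d) : ℝ) * P))
        = c * k ^ (-((d + 2) * (N - d + 1) + (d + 3) * d + d * d : ℝ) / 2) *
          (c ^ P * k ^ (((2 * d + 4) * (d + 1) + (d + 2) * (N - d) : ℝ) * P) / Λ ^ P) * Λ ^ P := by
          field_simp
      _ ≤ C * k ^ ((2 * d + 4) * (ε + γ)) * Λ ^ P := by gcongr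
      _ ≤ _ := by gcongr
  have h8 : 0 < k ^ ((2 * d + 4) * (ε + γ)) := by positivity
  have h9 : c * c ^ P * k ^ ((2 * d + 4) * ε) ≤ C * Λ := by
    refine le_of_mul_le_mul_left ?_ h8
    linarith
  rw [div_mul_eq_mul_div, lt_div_iff₀ hC] at hlog
  linarith

end SchrodingerMaximal

/-- The first conjunct says that the optimal exponent is a genuine infimum (the set of admissible
exponents is non-empty and bounded below); the second is the lower bound. The value `p = ∞` is
included, with `1 / p = 0`. -/
theorem theorem1p1 (n : ℕ) (hn : 3 ≤ n) (p : ℝ≥0∞) (hp : 2 ≤ p) (m : ℕ) (hm : 1 ≤ m)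
    (hmn : m ≤ n) :
    IsGLB {γ : ℝ | SchrodingerMaximal.IsAdmissible n p γ}
        (SchrodingerMaximal.optimalExponent n p) ∧
      ((n : ℝ) + m) / 2 * ((p⁻¹).toReal - 1 / 2) + (m : ℝ) / (2 * ((m : ℝ) + 1)) ≤
        SchrodingerMaximal.optimalExponent n p := by
  obtain ⟨N, rfl⟩ : ∃ N, n = N + 1 := ⟨n - 1, by omega⟩
  -- The parameter `m` counts the `d` comb directions together with the first coordinate, which
  -- selects the time.
  obtain ⟨d, rfl⟩ : ∃ d, m = d + 1 := ⟨m - 1, by omega⟩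
  have hne : {γ : ℝ | SchrodingerMaximal.IsAdmissible (N + 1) p γ}.Nonempty :=
    SchrodingerMaximal.exists_isAdmissible (N + 1) p
  have hlb : ∀ γ ∈ {γ : ℝ | SchrodingerMaximal.IsAdmissible (N + 1) p γ},
      (((N + 1 : ℕ) : ℝ) + (d + 1 : ℕ)) / 2 * ((p⁻¹).toReal - 1 / 2) +
        ((d + 1 : ℕ) : ℝ) / (2 * (((d + 1 : ℕ) : ℝ) + 1)) ≤ γ := by
    intro γ hγ
    push_cast
    exact SchrodingerMaximal.le_of_isAdmissible (by omega) hp hγ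
  exact ⟨isGLB_csInf hne ⟨_, hlb⟩, le_csInf hne hlb⟩
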